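/- A polyhedron $P\subset\mathbb{R}^3$ is here a nonempty finite union of convex hulls of finite point sets (convexity of $P$ is not required) that is the closure of its interior and has the following property: apart from finitely many points (vertices), every boundary point has a neighbourhood in which $P$ coincides with a wedge of some opening angle $\alpha\in(0,2\pi)$ whose edge passes through that point. So such a point is interior to a face ($\alpha=\pi$) or lies on an edge along which exactly two faces meet at interior dihedral angle $\alpha\neq\pi$. Let $V(P)$ be the volume of $P$, and let $\theta$ be the smallest interior dihedral angle $\alpha\ne\pi$ at which two faces of $P$ meet along an edge. For each $N\ge 1$ let $X_N=\{x_1,\dots,x_N\}$ consist of $N$ independent random points, each uniformly distributed on $P$ (i.e. with respect to $\mathbf 1_P\,dx/V(P)$), and let $$\rho(X_N,P)=\sup_{y\in P}\min_{1\le j\le N}|y-x_j|$$ be the covering radius. Then for every real $p\ge 1$ the random variable $\rho(X_N,P)^p$ is integrable for every $N$, and, with $\upsilon_3=4\pi/3$ the volume of the unit ball of $\mathbb{R}^3$, $$\lim_{N\to\infty}\mathbb{E}[\rho(X_N,P)^p]\left[\frac{N}{\log N}\right]^{p/3}=\left(\frac{2\pi V(P)}{3\theta\upsilon_3}\right)^{p/3}=\left(\frac{V(P)}{2\theta}\right)^{p/3}\quad\text{if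 }\theta\le\frac{\pi}{2},$$ $$\lim_{N\to\infty}\mathbb{E}[\rho(X_N,P)^p]\left[\frac{N}{\log N}\right]^{p/3}=\left(\frac{V(P)}{\pi}\right)^{p/3}\quad\text{if }\theta\ge\frac{\pi}{2}.$$ -/

import Mathlib

open MeasureTheory ProbabilityTheory Filter Topology Set

/-- The covering radius `sup_{y ∈ P} min_j |y - x_j|` of a configuration of `N` points with respect
to a set `P` of a metric space (for bounded `P` and `N ≥ 1` the supremum is a genuine one). -/
noncomputable def coveringRadius {E : Type*} [MetricSpace E] (P : Set E) {N : ℕ}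
    (x : Fin N → E) : ℝ :=
  ⨆ y : P, ⨅ j : Fin N, dist (y : E) (x j)

/-- For orthonormal `u, v` in `ℝ³`: the closed dihedral wedge of opening angle `α` whose edge is the
line through `x` orthogonal to `u` and `v`. It consists of the points whose orthogonal projection to
the plane through `x` spanned by `u, v` has polar coordinates `(s, t)` with `s ≥ 0`, `0 ≤ t ≤ α`.
It is bounded by the two half-planes `t = 0` and `t = α`, and it is a half-space for `α = π`. -/
def dihedralWedge (x u v : EuclideanSpace ℝ (Fin 3)) (α : ℝ) : Set (EuclideanSpace ℝ (Fin 3)) :=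
  {y | ∃ s : ℝ, 0 ≤ s ∧ ∃ t ∈ Icc 0 α,
    inner ℝ u (y - x) = s * Real.cos t ∧ inner ℝ v (y - x) = s * Real.sin t}

/-- Near the point `x`, the set `P` coincides with a dihedral wedge of opening angle `α` whose edge
passes through `x`. -/
def IsWedgeNear (P : Set (EuclideanSpace ℝ (Fin 3))) (x : EuclideanSpace ℝ (Fin 3)) (α : ℝ) :
    Prop :=
  ∃ u v : EuclideanSpace ℝ (Fin 3), ‖u‖ = 1 ∧ ‖v‖ = 1 ∧ inner ℝ u v = 0 ∧
    ∃ r : ℝ, 0 < r ∧ P ∩ Metric.ball x r = dihedralWedge x u v α ∩ Metric.ball x r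

/-- A (solid, compact, not necessarily convex) polyhedron in `ℝ³`. -/
structure IsPolyhedron (P : Set (EuclideanSpace ℝ (Fin 3))) : Prop where
  nonempty : P.Nonempty
  /-- `P` is a finite union of convex polytopes. -/
  finite_union : ∃ S : Finset (Finset (EuclideanSpace ℝ (Fin 3))),
    P = ⋃ s ∈ S, convexHull ℝ (s : Set (EuclideanSpace ℝ (Fin 3)))
  /-- `P` is solid: it has no parts of lower dimension. -/
  solid : closure (interior P) = P
  /-- Apart from finitely many vertices, every boundary point lies in the relative interior of a
  face (`α = π`) or of an edge in which exactly two faces meet, the solid lying on one side of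
  their union and filling there the angle `α`. -/
  boundary : ∃ vertices : Set (EuclideanSpace ℝ (Fin 3)), vertices.Finite ∧
    ∀ x ∈ frontier P \ vertices, ∃ α ∈ Ioo 0 (2 * Real.pi), IsWedgeNear P x α

/-- `α` is the dihedral angle, measured inside `P`, at which two faces of `P` meet along an edge:
near some point of the edge `P` is a wedge of opening angle `α`, the two boundary half-planes of
which are pieces of the two faces. (For `α = π` there is only one face and no edge.) -/
def IsDihedralAngle (P : Set (EuclideanSpace ℝ (Fin 3))) (α : ℝ) : Prop :=
  α ∈ Ioo 0 (2 * Real.pi) ∧ α ≠ Real.pi ∧ ∃ x, IsWedgeNear P x α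

/-! Let `V` be the volume of `P` and put `r = a (log N / N)^(1/3)`. If a ball of radius `r` meets
`P` in volume `w r³`, all `N` points miss it with probability about `exp (-N w r³ / V) = N^(-w a³ /
V)`. Around a piece of `P` of dimension `k` there is room for about `r^(-k)`, that is `N^(k/3)` up
to logarithms, essentially different balls. Such balls are therefore missed somewhere precisely when
`a³` is below the threshold `k V / (3 w)`. Vertices (`k = 0`) have threshold `0` whatever `w > 0`
is. An edge of angle `α ≤ π` has `w = 2α/3` and threshold `V / (2α)`, a face has `w = 2π/3` and
threshold `V / π`, and the interior has `w = 4π/3` and the smaller threshold `3V / (4π)`. The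
largest threshold decides: the edges of angle `θ` if `θ ≤ π/2`, the faces if `θ ≥ π/2`.

The upper bound is a union bound over nets (`measureReal_coveringRadius_gt_le`) and needs lower
volume bounds that hold for every centre in `P`, not only on the strata. For this `P` is regarded as
a union of cells of a finite hyperplane arrangement. By `exists_isolated_planeInter` each point is
within `b r` of a flat whose chosen point is at least `(b + 4) r` away from all other hyperplanes.
At this scale `P` is a cone about that point (`IsArranged.homothety_mem`), and the dimension of the
flat gives the volume bound (`volume_ge_of_finrank`). These points are collected in nets by
`IsPolyhedron.exists_nets`.

The lower bound places many disjoint balls along an edge or on a face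
(`IsWedgeNear.exists_separated_edge`, `IsWedgeNear.exists_separated_face`). The events that they are
missed are negatively correlated, so the second moment method applies
(`measureReal_coveringRadius_lt_mul_le`). Finally `tendsto_integral_rpow_of_tails` turns
concentration into convergence of moments, using the diameter as a bound on events of probability
`o(N^(-p/3))`. -/

/-! ### Dihedral wedges and the volumes they cut out of balls -/

theorem exists_polar_iff {α : ℝ} (h0 : 0 < α) (hπ : α ≤ Real.pi) (a b : ℝ) :
    (∃ s : ℝ, 0 ≤ s ∧ ∃ t ∈ Icc 0 α, a = s * Real.cos t ∧ b = s * Real.sin t) ↔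
      0 ≤ b ∧ 0 ≤ a * Real.sin α - b * Real.cos α := by
  constructor
  · rintro ⟨s, hs, t, ⟨ht0, ht⟩, rfl, rfl⟩
    refine ⟨mul_nonneg hs (Real.sin_nonneg_of_nonneg_of_le_pi ht0 (ht.trans hπ)), ?_⟩
    have : s * Real.cos t * Real.sin α - s * Real.sin t * Real.cos α = s * Real.sin (α - t) := by
      rw [Real.sin_sub]; ring
    rw [this]
    exact mul_nonneg hs (Real.sin_nonneg_of_nonneg_of_le_pi (by linarith) (by linarith))
  · rintro ⟨hb, hab⟩
    let z : ℂ := ⟨a, b⟩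
    have hre : a = ‖z‖ * Real.cos z.arg := (Complex.norm_mul_cos_arg z).symm
    have him : b = ‖z‖ * Real.sin z.arg := (Complex.norm_mul_sin_arg z).symm
    have harg0 : 0 ≤ z.arg := Complex.arg_nonneg_iff.2 hb
    have hargπ : z.arg ≤ Real.pi := Complex.arg_le_pi z
    rcases eq_or_ne ‖z‖ 0 with hz | hz
    · refine ⟨0, le_rfl, 0, ⟨le_rfl, h0.le⟩, ?_, ?_⟩
      · rw [hre, hz, zero_mul, zero_mul]
      · rw [him, hz, zero_mul, zero_mul]
    · refine ⟨‖z‖, norm_nonneg _, z.arg, ⟨harg0, ?_⟩, hre, him⟩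
      by_contra! hlt
      have hz' : 0 < ‖z‖ := lt_of_le_of_ne (norm_nonneg _) (Ne.symm hz)
      -- The second linear form is `‖z‖ sin (α - arg z)`, which is negative once `α < arg z ≤ π`.
      have h1 : a * Real.sin α - b * Real.cos α = ‖z‖ * Real.sin (α - z.arg) := by
        rw [Real.sin_sub]
        conv_lhs => rw [hre, him]
        ring
      have h2 : Real.sin (α - z.arg) < 0 :=
        Real.sin_neg_of_neg_of_neg_pi_lt (by linarith) (by linarith)
      have := mul_neg_of_pos_of_neg hz' h2
      linarith

/-- In cylindrical coordinates about the edge both volumes are the same integral `∫ J` times an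
angle, so that integral need not be evaluated. The product form avoids division in `ENNReal`. -/
theorem volume_sector_mul {α : ℝ} (h0 : 0 < α) (hπ : α ≤ Real.pi) (r : ℝ) :
    volume {p : ℝ × ℝ × ℝ | (0 ≤ p.2.2 ∧ 0 ≤ p.2.1 * Real.sin α - p.2.2 * Real.cos α) ∧
        p.1 ^ 2 + p.2.1 ^ 2 + p.2.2 ^ 2 < r ^ 2} * ENNReal.ofReal (2 * Real.pi) =
      ENNReal.ofReal α * volume {p : ℝ × ℝ × ℝ | p.1 ^ 2 + p.2.1 ^ 2 + p.2.2 ^ 2 < r ^ 2} := by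
  set A : Set (ℝ × ℝ × ℝ) := {p | (0 ≤ p.2.2 ∧ 0 ≤ p.2.1 * Real.sin α - p.2.2 * Real.cos α) ∧
        p.1 ^ 2 + p.2.1 ^ 2 + p.2.2 ^ 2 < r ^ 2} with hA
  set B : Set (ℝ × ℝ × ℝ) := {p | p.1 ^ 2 + p.2.1 ^ 2 + p.2.2 ^ 2 < r ^ 2} with hB
  have hBm : MeasurableSet B := by
    apply measurableSet_lt <;> fun_prop
  have hAm : MeasurableSet A := by
    have h1 : MeasurableSet {p : ℝ × ℝ × ℝ | 0 ≤ p.2.2} := by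
      apply measurableSet_le <;> fun_prop
    have h2 : MeasurableSet {p : ℝ × ℝ × ℝ | 0 ≤ p.2.1 * Real.sin α - p.2.2 * Real.cos α} := by
      apply measurableSet_le <;> fun_prop
    exact (h1.inter h2).inter hBm
  let J : ℝ → ENNReal := fun z => ∫⁻ s in Ioi (0 : ℝ),
    ENNReal.ofReal s * ({s : ℝ | z ^ 2 + s ^ 2 < r ^ 2}.indicator 1 s)
  have key : ∀ (T : Set ℝ) (C : Set (ℝ × ℝ × ℝ)), MeasurableSet T → MeasurableSet C →
      (∀ z s t, s ∈ Ioi (0 : ℝ) → t ∈ Ioo (-Real.pi) Real.pi →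
        ((z, s * Real.cos t, s * Real.sin t) ∈ C ↔ t ∈ T ∧ z ^ 2 + s ^ 2 < r ^ 2)) →
      volume C = (∫⁻ z, J z) * volume (T ∩ Ioo (-Real.pi) Real.pi) := by
    intro T C hT hC h
    rw [Measure.volume_eq_prod, Measure.prod_apply hC, ← lintegral_mul_const']
    · apply lintegral_congr
      intro z
      have hCz : MeasurableSet (Prod.mk z ⁻¹' C) := measurable_prodMk_left hC
      rw [← lintegral_indicator_one hCz, ← lintegral_comp_polarCoord_symm, polarCoord_target]
      have h1 : ∀ p ∈ Ioi (0 : ℝ) ×ˢ Ioo (-Real.pi) Real.pi,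
          ENNReal.ofReal p.1 • (Prod.mk z ⁻¹' C).indicator 1 (polarCoord.symm p) =
          (ENNReal.ofReal p.1 * ({s : ℝ | z ^ 2 + s ^ 2 < r ^ 2}.indicator 1 p.1)) *
            T.indicator (1 : ℝ → ENNReal) p.2 := by
        rintro ⟨s, t⟩ ⟨hs, ht⟩
        have := h z s t hs ht
        by_cases h1 : t ∈ T <;> by_cases h2 : z ^ 2 + s ^ 2 < r ^ 2 <;>
          simp [indicator, this, h1, h2]
      rw [setLIntegral_congr_fun (measurableSet_Ioi.prod measurableSet_Ioo) h1,
        Measure.volume_eq_prod, ← Measure.prod_restrict,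
          lintegral_prod_mul (f := fun s => ENNReal.ofReal s *
            {s : ℝ | z ^ 2 + s ^ 2 < r ^ 2}.indicator 1 s)]
      · rw [lintegral_indicator_one hT, Measure.restrict_apply hT]
      · apply Measurable.aemeasurable
        apply Measurable.mul (by fun_prop)
        apply Measurable.indicator measurable_const
        apply measurableSet_lt <;> fun_prop
      · exact (measurable_const.indicator hT).aemeasurable
    · exact ((measure_mono inter_subset_right).trans_lt measure_Ioo_lt_top).ne
  have e1 : volume A = (∫⁻ z, J z) * ENNReal.ofReal α := by
    rw [key (Icc 0 α) A measurableSet_Icc hAm]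
    · have hsub : volume (Icc 0 α ∩ Ioo (-Real.pi) Real.pi) = volume (Icc 0 α) := by
        apply measure_congr
        have : ∀ᵐ x : ℝ, x ≠ Real.pi := by simp [ae_iff]
        filter_upwards [this] with x hx
        apply propext
        change (x ∈ Icc 0 α ∧ x ∈ Ioo (-Real.pi) Real.pi) ↔ x ∈ Icc 0 α
        constructor
        · exact fun h => h.1
        · intro h
          exact ⟨h, by linarith [h.1, Real.pi_pos], lt_of_le_of_ne (h.2.trans hπ) hx⟩
      rw [hsub, Real.volume_Icc, sub_zero]
    · intro z s t (hs : 0 < s) ht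
      have e : s * Real.cos t * Real.sin α - s * Real.sin t * Real.cos α
          = s * Real.sin (α - t) := by rw [Real.sin_sub]; ring
      have e' : z ^ 2 + (s * Real.cos t) ^ 2 + (s * Real.sin t) ^ 2 = z ^ 2 + s ^ 2 := by
        nlinarith [Real.sin_sq_add_cos_sq t]
      simp only [hA, mem_ofPred_eq, e, e', mul_nonneg_iff_of_pos_left hs]
      refine and_congr_left fun _ => ?_
      constructor
      · rintro ⟨h1, h2⟩
        have h3 : 0 ≤ t := by
          by_contra! h3
          linarith [Real.sin_neg_of_neg_of_neg_pi_lt h3 ht.1]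
        refine ⟨h3, ?_⟩
        by_contra! h4
        linarith [Real.sin_neg_of_neg_of_neg_pi_lt (x := α - t) (by linarith) (by linarith [ht.2])]
      · rintro ⟨h1, h2⟩
        exact ⟨Real.sin_nonneg_of_nonneg_of_le_pi h1 ht.2.le,
          Real.sin_nonneg_of_nonneg_of_le_pi (by linarith) (by linarith)⟩
  have e2 : volume B = (∫⁻ z, J z) * ENNReal.ofReal (2 * Real.pi) := by
    rw [key univ B MeasurableSet.univ hBm]
    · rw [univ_inter, Real.volume_Ioo]; congr 2; ring
    · intro z s t _ _
      have e' : z ^ 2 + (s * Real.cos t) ^ 2 + (s * Real.sin t) ^ 2 = z ^ 2 + s ^ 2 := by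
        nlinarith [Real.sin_sq_add_cos_sq t]
      simp [hB, e']
  rw [e1, e2]; ring

theorem mem_dihedralWedge_iff {α : ℝ} (h0 : 0 < α) (hπ : α ≤ Real.pi)
    (x u v y : EuclideanSpace ℝ (Fin 3)) :
    y ∈ dihedralWedge x u v α ↔ 0 ≤ inner ℝ v (y - x) ∧
      0 ≤ inner ℝ u (y - x) * Real.sin α - inner ℝ v (y - x) * Real.cos α :=
  exists_polar_iff h0 hπ _ _

theorem exists_orthonormalBasis_of_pair {u v : EuclideanSpace ℝ (Fin 3)} (hu : ‖u‖ = 1)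
    (hv : ‖v‖ = 1) (huv : inner ℝ u v = 0) :
    ∃ b : OrthonormalBasis (Fin 3) ℝ (EuclideanSpace ℝ (Fin 3)), b 1 = u ∧ b 2 = v := by
  have hvu : inner ℝ v u = 0 := by rw [real_inner_comm, huv]
  obtain ⟨b, hb⟩ := Orthonormal.exists_orthonormalBasis_extension_of_card_eq (𝕜 := ℝ)
    (E := EuclideanSpace ℝ (Fin 3)) (ι := Fin 3) (by simp) (v := ![0, u, v]) (s := {1, 2}) (by
      constructor
      · rintro ⟨i, hi⟩
        rcases hi with rfl | rfl <;> simp [hu, hv]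
      · rintro ⟨i, hi⟩ ⟨j, hj⟩ hij
        rcases hi with rfl | rfl <;> rcases hj with rfl | rfl <;> simp [huv, hvu] at hij ⊢)
  exact ⟨b, by simpa using hb 1 (by simp), by simpa using hb 2 (by simp)⟩

theorem volume_dihedralWedge_inter_ball {α : ℝ} (h0 : 0 < α) (hπ : α ≤ Real.pi)
    {u v : EuclideanSpace ℝ (Fin 3)} (hu : ‖u‖ = 1) (hv : ‖v‖ = 1) (huv : inner ℝ u v = 0)
    (x : EuclideanSpace ℝ (Fin 3)) {r : ℝ} (hr : 0 ≤ r) :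
    volume.real (dihedralWedge x u v α ∩ Metric.ball x r) = 2 * α / 3 * r ^ 3 := by
  obtain ⟨b, rfl, rfl⟩ := exists_orthonormalBasis_of_pair hu hv huv
  let φ : EuclideanSpace ℝ (Fin 3) → ℝ × ℝ × ℝ := fun y => (b.repr y 0, b.repr y 1, b.repr y 2)
  have hφ : MeasurePreserving φ volume volume := by
    have h1 := b.measurePreserving_repr
    have h2 := PiLp.volume_preserving_ofLp (Fin 3)
    have h3 := volume_preserving_piFinSuccAbove (fun _ : Fin 3 => ℝ) 0
    have h4 := volume_preserving_finTwoArrow ℝ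
    have h5 := (MeasurePreserving.id (volume : Measure ℝ)).prod h4
    exact h5.comp (h3.comp (h2.comp h1))
  have hφx : MeasurePreserving (fun y => φ (y - x)) volume volume :=
    hφ.comp (measurePreserving_sub_right volume x)
  have hball : ∀ y, y ∈ Metric.ball x r ↔
      (b.repr (y - x) 0) ^ 2 + (b.repr (y - x) 1) ^ 2 + (b.repr (y - x) 2) ^ 2 < r ^ 2 := by
    intro y
    rw [mem_ball_iff_norm, ← b.repr.norm_map, EuclideanSpace.norm_eq,
      Real.sqrt_lt (by positivity) hr, Fin.sum_univ_three]
    simp only [Real.norm_eq_abs, sq_abs]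
  set A : Set (ℝ × ℝ × ℝ) := {p | (0 ≤ p.2.2 ∧ 0 ≤ p.2.1 * Real.sin α - p.2.2 * Real.cos α) ∧
        p.1 ^ 2 + p.2.1 ^ 2 + p.2.2 ^ 2 < r ^ 2} with hA
  set B : Set (ℝ × ℝ × ℝ) := {p | p.1 ^ 2 + p.2.1 ^ 2 + p.2.2 ^ 2 < r ^ 2} with hB
  have hBm : MeasurableSet B := by
    apply measurableSet_lt <;> fun_prop
  have hAm : MeasurableSet A := by
    have h1 : MeasurableSet {p : ℝ × ℝ × ℝ | 0 ≤ p.2.2} := by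
      apply measurableSet_le <;> fun_prop
    have h2 : MeasurableSet {p : ℝ × ℝ × ℝ | 0 ≤ p.2.1 * Real.sin α - p.2.2 * Real.cos α} := by
      apply measurableSet_le <;> fun_prop
    exact (h1.inter h2).inter hBm
  have e1 : volume A = volume (dihedralWedge x (b 1) (b 2) α ∩ Metric.ball x r) := by
    rw [← hφx.measure_preimage hAm.nullMeasurableSet]
    congr 1
    ext y
    rw [mem_inter_iff, hball, mem_dihedralWedge_iff h0 hπ, ← b.repr_apply_apply,
      ← b.repr_apply_apply]
    rfl
  have e2 : volume B = volume (Metric.ball x r) := by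
    rw [← hφx.measure_preimage hBm.nullMeasurableSet]
    congr 1
    ext y
    rw [hball]
    rfl
  have h := congrArg ENNReal.toReal (volume_sector_mul h0 hπ r)
  rw [← hA, ← hB, e1, e2, ENNReal.toReal_mul, ENNReal.toReal_mul,
    EuclideanSpace.volume_ball_fin_three, ENNReal.toReal_mul, ENNReal.toReal_pow,
    ENNReal.toReal_ofReal hr, ENNReal.toReal_ofReal h0.le,
    ENNReal.toReal_ofReal (by positivity), ENNReal.toReal_ofReal (by positivity)] at h
  rw [measureReal_def]
  have hp := Real.pi_pos
  field_simp at h ⊢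
  linarith

theorem volume_real_ball_fin_three (x : EuclideanSpace ℝ (Fin 3)) {r : ℝ} (hr : 0 ≤ r) :
    volume.real (Metric.ball x r) = 4 * Real.pi / 3 * r ^ 3 := by
  rw [measureReal_def, EuclideanSpace.volume_ball_fin_three, ENNReal.toReal_mul,
    ENNReal.toReal_pow, ENNReal.toReal_ofReal hr, ENNReal.toReal_ofReal (by positivity)]
  ring

/-- For `α ≤ π` the wedge is a convex cone modulo its edge, hence stable under addition of the
vectors it contains. -/
theorem dihedralWedge_subset_of_mem {α : ℝ} (h0 : 0 < α) (hπ : α ≤ Real.pi)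
    {x y u v : EuclideanSpace ℝ (Fin 3)} (hy : y ∈ dihedralWedge x u v α) :
    dihedralWedge y u v α ⊆ dihedralWedge x u v α := by
  intro z hz
  rw [mem_dihedralWedge_iff h0 hπ] at hy hz ⊢
  have e : z - x = (z - y) + (y - x) := by abel
  rw [e, inner_add_right, inner_add_right]
  constructor
  · linarith
  · nlinarith

theorem exists_halfspace_subset_dihedralWedge {α : ℝ} (hπ : Real.pi ≤ α)
    {x y u v : EuclideanSpace ℝ (Fin 3)} (hu : ‖u‖ = 1) (hv : ‖v‖ = 1) (huv : inner ℝ u v = 0)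
    (hy : y ∈ dihedralWedge x u v α) :
    ∃ u' v' : EuclideanSpace ℝ (Fin 3), ‖u'‖ = 1 ∧ ‖v'‖ = 1 ∧ inner ℝ u' v' = 0 ∧
      y ∈ dihedralWedge x u' v' Real.pi ∧
      dihedralWedge x u' v' Real.pi ⊆ dihedralWedge x u v α := by
  obtain ⟨s, hs, t, ⟨ht0, ht⟩, h1, h2⟩ := hy
  -- The half-space consists of the angles in `[τ, τ + π]`. This choice of `τ` keeps that interval
  -- inside `[0, α]` and makes it contain the angle `t` of `y`; the frame `u, v` is rotated by `τ`.
  set τ := min t (α - Real.pi) with hτ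
  have hτ0 : 0 ≤ τ := le_min ht0 (by linarith)
  have hτ1 : τ ≤ t := min_le_left _ _
  have hτ2 : τ + Real.pi ≤ α := by linarith [min_le_right t (α - Real.pi)]
  have hτ3 : t ≤ τ + Real.pi := by
    rcases min_choice t (α - Real.pi) with h | h <;> rw [hτ, h] <;> linarith [Real.pi_pos]
  have hvu : inner ℝ v u = 0 := by rw [real_inner_comm, huv]
  have huu : inner ℝ u u = 1 := by rw [real_inner_self_eq_norm_sq, hu]; norm_num
  have hvv : inner ℝ v v = 1 := by rw [real_inner_self_eq_norm_sq, hv]; norm_num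
  have hsc := Real.sin_sq_add_cos_sq τ
  refine ⟨Real.cos τ • u + Real.sin τ • v, -Real.sin τ • u + Real.cos τ • v, ?_, ?_, ?_, ?_, ?_⟩
  · rw [← sq_eq_sq₀ (norm_nonneg _) zero_le_one, ← real_inner_self_eq_norm_sq]
    simp only [inner_add_left, inner_add_right, inner_smul_left, inner_smul_right, huu, hvv, huv,
      hvu, RCLike.conj_to_real]
    nlinarith
  · rw [← sq_eq_sq₀ (norm_nonneg _) zero_le_one, ← real_inner_self_eq_norm_sq]
    simp only [inner_add_left, inner_add_right, inner_smul_left, inner_smul_right, huu, hvv, huv,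
      hvu, RCLike.conj_to_real]
    nlinarith
  · simp only [inner_add_left, inner_add_right, inner_smul_left, inner_smul_right, huu, hvv, huv,
      hvu, RCLike.conj_to_real]
    ring
  · refine ⟨s, hs, t - τ, ⟨by linarith, by linarith⟩, ?_, ?_⟩
    · simp only [inner_add_left, inner_smul_left, RCLike.conj_to_real, h1, h2, Real.cos_sub]
      ring
    · simp only [inner_add_left, inner_smul_left, RCLike.conj_to_real, h1, h2, Real.sin_sub]
      ring
  · rintro z ⟨s', hs', t', ⟨ht0', ht'⟩, h1', h2'⟩
    refine ⟨s', hs', t' + τ, ⟨by linarith, by linarith⟩, ?_, ?_⟩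
    · simp only [inner_add_left, inner_smul_left, RCLike.conj_to_real] at h1' h2'
      rw [Real.cos_add]
      linear_combination Real.cos τ * h1' - Real.sin τ * h2' - inner ℝ u (z - x) * hsc
    · simp only [inner_add_left, inner_smul_left, RCLike.conj_to_real] at h1' h2'
      rw [Real.sin_add]
      linear_combination Real.sin τ * h1' + Real.cos τ * h2' - inner ℝ v (z - x) * hsc

/-- A ball centred at a point of a wedge meets the wedge in at least as much volume as a ball
centred on the edge, or as a half-ball if the angle is reflex. -/
theorem le_volume_dihedralWedge_inter_ball {α : ℝ} (h0 : 0 < α)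
    {x y u v : EuclideanSpace ℝ (Fin 3)} (hu : ‖u‖ = 1) (hv : ‖v‖ = 1) (huv : inner ℝ u v = 0)
    (hy : y ∈ dihedralWedge x u v α) {r : ℝ} (hr : 0 ≤ r) :
    2 * min α Real.pi / 3 * r ^ 3 ≤ volume.real (dihedralWedge x u v α ∩ Metric.ball y r) := by
  have hfin : volume (dihedralWedge x u v α ∩ Metric.ball y r) ≠ ⊤ :=
    ((measure_mono inter_subset_right).trans_lt measure_ball_lt_top).ne
  rcases le_total α Real.pi with h | h
  · rw [min_eq_left h, ← volume_dihedralWedge_inter_ball h0 h hu hv huv y hr]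
    exact measureReal_mono (inter_subset_inter_left _ (dihedralWedge_subset_of_mem h0 h hy)) hfin
  · obtain ⟨u', v', hu', hv', huv', hy', hsub⟩ :=
      exists_halfspace_subset_dihedralWedge h hu hv huv hy
    rw [min_eq_right h,
      ← volume_dihedralWedge_inter_ball Real.pi_pos le_rfl hu' hv' huv' y hr]
    exact measureReal_mono (inter_subset_inter_left _
      ((dihedralWedge_subset_of_mem Real.pi_pos le_rfl hy').trans hsub)) hfin

/-! ### Finite hyperplane arrangements -/

/-- The union of the affine hyperplanes `⟪n, x⟫ = c`, `(n, c) ∈ H`. -/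
def planeUnion {E : Type*} [NormedAddCommGroup E] [InnerProductSpace ℝ E] (H : Finset (E × ℝ)) :
    Set E :=
  {x | ∃ h ∈ H, inner ℝ h.1 x = h.2}

/-- The intersection of the affine hyperplanes `⟪n, x⟫ = c`, `(n, c) ∈ I`. -/
def planeInter {E : Type*} [NormedAddCommGroup E] [InnerProductSpace ℝ E] (I : Finset (E × ℝ)) :
    Set E :=
  {x | ∀ h ∈ I, inner ℝ h.1 x = h.2}

section Hyperplanes

variable {E : Type*} [NormedAddCommGroup E] [InnerProductSpace ℝ E] [FiniteDimensional ℝ E]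

theorem exists_unit_normal_of_const {s : Set E} {x : E} {f : StrongDual ℝ E} (hf : f ≠ 0)
    (hs : ∀ y ∈ s, f y = f x) :
    ∃ n : E, ‖n‖ = 1 ∧ ∀ y ∈ s, inner ℝ n y = inner ℝ n x := by
  set m := (InnerProductSpace.toDual ℝ E).symm f with hm
  have hm0 : m ≠ 0 := by simpa [hm] using hf
  have hfm : ∀ y, f y = inner ℝ m y := fun y => by simp [hm]
  refine ⟨‖m‖⁻¹ • m, ?_, fun y hy => ?_⟩
  · rw [norm_smul, norm_inv, norm_norm, inv_mul_cancel₀ (norm_ne_zero_iff.2 hm0)]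
  · rw [inner_smul_left, inner_smul_left, ← hfm, ← hfm, hs y hy]

/-- A non-interior point of a polytope is a convex combination of only those generators that lie on
a supporting hyperplane; a polytope without interior lies in a hyperplane as a whole. Since `s` has
finitely many subsets, finitely many hyperplanes will suffice. -/
theorem exists_supporting_subset (s : Finset E) {x : E} (hx : x ∈ convexHull ℝ (s : Set E))
    (hxi : x ∉ interior (convexHull ℝ (s : Set E))) :
    ∃ s' ⊆ s, x ∈ convexHull ℝ (s' : Set E) ∧
      ∃ h : E × ℝ, ‖h.1‖ = 1 ∧ ∀ y ∈ s', inner ℝ h.1 y = h.2 := by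
  classical
  set K := convexHull ℝ (s : Set E) with hK
  have hKc : Convex ℝ K := convex_convexHull ℝ _
  rcases (interior K).eq_empty_or_nonempty with he | hne
  · have hspan : affineSpan ℝ K ≠ ⊤ := by
      rw [Ne, ← hKc.interior_nonempty_iff_affineSpan_eq_top, he]
      exact not_nonempty_empty
    have hdir : vectorSpan ℝ K < ⊤ := by
      rw [lt_top_iff_ne_top]
      intro h
      exact hspan ((AffineSubspace.affineSpan_eq_top_iff_vectorSpan_eq_top_of_nonempty
        ℝ E E ⟨x, hx⟩).2 h)
    obtain ⟨f, hf0, hf⟩ := Submodule.exists_dual_map_eq_bot_of_lt_top hdir inferInstance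
    obtain ⟨n, hn, hn'⟩ := exists_unit_normal_of_const (s := K) (x := x)
      (f := LinearMap.toContinuousLinearMap f) (by simpa using hf0) (by
        intro y hy
        have : f (y - x) ∈ (vectorSpan ℝ K).map f :=
          Submodule.mem_map_of_mem (vsub_mem_vectorSpan ℝ hy hx)
        rw [hf, Submodule.mem_bot, map_sub, sub_eq_zero] at this
        simpa using this)
    exact ⟨s, subset_rfl, hx, (n, inner ℝ n x), hn,
      fun y hy => hn' y (subset_convexHull ℝ _ hy)⟩
  · obtain ⟨f, c, hf0, hfc, hcf⟩ := geometric_hahn_banach_of_nonempty_interior hKc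
      (convex_singleton x) (disjoint_singleton_right.2 hxi) hne (singleton_nonempty x)
    have hcx : c ≤ f x := hcf x rfl
    have hle : ∀ y ∈ s, f y ≤ f x := fun y hy => (hfc y (subset_convexHull ℝ _ hy)).trans hcx
    obtain ⟨n, hn, hn'⟩ := exists_unit_normal_of_const (s := {y | f y = f x}) (x := x) hf0
      (fun y hy => hy)
    refine ⟨s.filter (fun y => f y = f x), Finset.filter_subset _ _, ?_,
      (n, inner ℝ n x), hn, fun y hy => hn' y (Finset.mem_filter.1 hy).2⟩
    obtain ⟨w, hw0, hw1, hwx⟩ := Finset.mem_convexHull'.1 hx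
    -- A vanishing sum of nonnegative terms: every weight off the supporting hyperplane is zero.
    have hsum : ∑ y ∈ s, w y * (f x - f y) = 0 := by
      have : f x = ∑ y ∈ s, w y * f y := by
        conv_lhs => rw [← hwx]
        simp [map_sum]
      simp only [mul_sub, Finset.sum_sub_distrib, ← Finset.sum_mul, hw1, one_mul, ← this, sub_self]
    have hz : ∀ y ∈ s, w y * (f x - f y) = 0 :=
      (Finset.sum_eq_zero_iff_of_nonneg
        (fun y hy => mul_nonneg (hw0 y hy) (sub_nonneg.2 (hle y hy)))).1 hsum
    have hz' : ∀ y ∈ s, ¬ f y = f x → w y = 0 := fun y hy hne => by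
      rcases mul_eq_zero.1 (hz y hy) with h | h
      · exact h
      · exact absurd (sub_eq_zero.1 h).symm hne
    rw [Finset.mem_convexHull']
    refine ⟨w, fun y hy => hw0 y (Finset.mem_filter.1 hy).1, ?_, ?_⟩
    · rw [← hw1, Finset.sum_filter_of_ne]
      intro y hy hne
      by_contra h
      exact hne (hz' y hy h)
    · refine Eq.trans (Finset.sum_filter_of_ne ?_) hwx
      intro y hy hne
      by_contra h
      exact hne (by rw [hz' y hy h, zero_smul])

theorem exists_planes (S : Finset (Finset E)) :
    ∃ H : Finset (E × ℝ), (∀ h ∈ H, ‖h.1‖ = 1) ∧ ∀ s ∈ S, ∀ x ∈ convexHull ℝ (s : Set E),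
      x ∉ interior (convexHull ℝ (s : Set E)) → x ∈ planeUnion H := by
  classical
  -- One hyperplane is chosen for each subset that lies in one. The default `0` for the other
  -- subsets is removed by the filter on unit normals.
  have : ∀ s' : Finset E, ∃ h : E × ℝ,
      (∃ h : E × ℝ, ‖h.1‖ = 1 ∧ ∀ y ∈ s', inner ℝ h.1 y = h.2) →
        ‖h.1‖ = 1 ∧ ∀ y ∈ s', inner ℝ h.1 y = h.2 := by
    intro s'
    by_cases h : ∃ h : E × ℝ, ‖h.1‖ = 1 ∧ ∀ y ∈ s', inner ℝ h.1 y = h.2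
    · exact ⟨h.choose, fun _ => h.choose_spec⟩
    · exact ⟨0, fun h' => absurd h' h⟩
  choose g hg using this
  refine ⟨((S.biUnion Finset.powerset).image g).filter (fun h => ‖h.1‖ = 1),
    fun h hh => (Finset.mem_filter.1 hh).2, ?_⟩
  intro s hs x hx hxi
  obtain ⟨s', hs', hxs', hex⟩ := exists_supporting_subset s hx hxi
  obtain ⟨h1, h2⟩ := hg s' hex
  refine ⟨g s', Finset.mem_filter.2 ⟨Finset.mem_image_of_mem _ (Finset.mem_biUnion.2
    ⟨s, hs, Finset.mem_powerset.2 hs'⟩), h1⟩, ?_⟩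
  have hconv : Convex ℝ {y : E | inner ℝ (g s').1 y = (g s').2} :=
    convex_hyperplane (f := fun y => inner ℝ (g s').1 y) (innerₗ E (g s').1).isLinear _
  exact convexHull_min (fun y hy => h2 y hy) hconv hxs'

theorem dense_compl_planeUnion {H : Finset (E × ℝ)} (hH : ∀ h ∈ H, ‖h.1‖ = 1) :
    Dense (planeUnion H)ᶜ := by
  have h1 : (planeUnion H)ᶜ = ⋂ h ∈ H, {x | inner ℝ h.1 x ≠ h.2} := by
    ext x
    simp only [planeUnion, mem_compl_iff, mem_ofPred_eq, not_exists, not_and, mem_iInter, ne_eq]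
  rw [h1]
  refine dense_biInter_of_isOpen (fun h _ => ?_) H.countable_toSet (fun h hh => ?_)
  · exact isOpen_ne_fun (by fun_prop) (by fun_prop)
  · intro x
    rw [mem_closure_iff_seq_limit]
    by_cases hx : inner ℝ h.1 x = h.2
    · refine ⟨fun k => x + ((1 : ℝ) / (k + 1)) • h.1, fun k => ?_, ?_⟩
      · have : (0 : ℝ) < 1 / (k + 1) := by positivity
        simp only [ne_eq, mem_ofPred_eq, inner_add_right, hx, inner_smul_right,
          real_inner_self_eq_norm_sq, hH h hh]
        intro h'
        linarith
      · have := (tendsto_one_div_add_atTop_nhds_zero_nat (𝕜 := ℝ)).smul_const h.1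
        simpa using this.const_add x
    · exact ⟨fun _ => x, fun _ => hx, tendsto_const_nhds⟩

/-- A point close to each of finitely many hyperplanes is close to their intersection. -/
theorem exists_mem_planeInter_norm_sub_le (I : Finset (E × ℝ)) :
    ∀ᶠ A : ℝ in atTop, ∀ y : E, ∀ R : ℝ, 0 ≤ R → A * R ≤ 1 →
      (∀ h ∈ I, |inner ℝ h.1 y - h.2| ≤ R) → ∃ z ∈ planeInter I, ‖y - z‖ ≤ A * R := by
  let T : E →ₗ[ℝ] (I → ℝ) := LinearMap.pi fun h => innerₗ E h.1.1
  let c : I → ℝ := fun h => h.1.2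
  have hdist : ∀ y : E, ∀ R : ℝ, 0 ≤ R → (∀ h ∈ I, |inner ℝ h.1 y - h.2| ≤ R) →
      ‖T y - c‖ ≤ R := by
    intro y R hR hy
    rw [pi_norm_le_iff_of_nonneg hR]
    rintro ⟨h, hh⟩
    exact hy h hh
  -- If the system `T x = c` is solvable, a bounded right inverse of `T` onto its range corrects `y`
  -- at a cost linear in the residual. Otherwise `c` has positive distance `δ` from the closed
  -- range, and `A > 1 / δ` makes residuals `R ≤ 1 / A` impossible.
  by_cases hc : c ∈ LinearMap.range T
  · obtain ⟨x₀, hx₀⟩ := hc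
    obtain ⟨g, hg⟩ := LinearMap.exists_rightInverse_of_surjective T.rangeRestrict
      T.range_rangeRestrict
    let g' := LinearMap.toContinuousLinearMap g
    filter_upwards [eventually_ge_atTop ‖g'‖] with A hA y R hR _ hy
    set w := T.rangeRestrict (y - x₀) with hw
    have hTw : (w : I → ℝ) = T y - c := by rw [hw, ← hx₀, ← map_sub]; rfl
    refine ⟨y - g w, fun h hh => ?_, ?_⟩
    · have h1 : T (g w) = T y - c := by
        rw [← hTw]
        exact congrArg Subtype.val (LinearMap.congr_fun hg w)
      have h2 := congrFun h1 ⟨h, hh⟩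
      have h3 : inner ℝ h.1 (g w) = inner ℝ h.1 y - h.2 := h2
      rw [inner_sub_right, h3]; ring
    · rw [sub_sub_cancel]
      calc ‖g w‖ ≤ ‖g'‖ * ‖w‖ := g'.le_opNorm w
        _ ≤ A * R := by
          apply mul_le_mul hA _ (norm_nonneg _) (le_trans (norm_nonneg g') hA)
          have hn : ‖w‖ = ‖(w : I → ℝ)‖ := rfl
          rw [hn, hTw]
          exact hdist y R hR hy
  · have hcl : IsClosed (LinearMap.range T : Set (I → ℝ)) := Submodule.closed_of_finiteDimensional _
    obtain ⟨δ, hδ, hball⟩ := Metric.isOpen_iff.1 hcl.isOpen_compl c hc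
    filter_upwards [eventually_gt_atTop (1 / δ)] with A hA y R hR hAR hy
    exfalso
    have h1 := hdist y R hR hy
    have hA0 : 0 < A := lt_trans (by positivity) hA
    have h2 : R < δ := by
      rw [div_lt_iff₀ hδ] at hA
      nlinarith
    exact hball (by rw [mem_ball_iff_norm]; linarith) (LinearMap.mem_range_self T y)

/-- Every point is, at each small scale `r`, within `b * r` of a flat of the arrangement `H`, at a
point of the flat that has distance at least `(b + 4) * r` from the other hyperplanes. -/
theorem exists_isolated_planeInter (H : Finset (E × ℝ)) :
    ∃ B : ℝ, 0 < B ∧ ∀ r : ℝ, 0 < r → B * r ≤ 1 → ∀ y : E, ∃ I ⊆ H, ∃ z ∈ planeInter I,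
      ∃ b : ℝ, 0 ≤ b ∧ b ≤ B ∧ ‖y - z‖ ≤ b * r ∧
        ∀ h ∈ H, h ∉ I → (b + 4) * r ≤ |inner ℝ h.1 z - h.2| := by
  classical
  obtain ⟨A, hA0, hA⟩ : ∃ A : ℝ, 0 < A ∧ ∀ I ∈ H.powerset, ∀ y : E, ∀ R : ℝ, 0 ≤ R → A * R ≤ 1 →
      (∀ h ∈ I, |inner ℝ h.1 y - h.2| ≤ R) → ∃ z ∈ planeInter I, ‖y - z‖ ≤ A * R :=
    ((eventually_gt_atTop 0).and ((Filter.eventually_all_finset _).2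
      fun I _ => exists_mem_planeInter_norm_sub_le I)).exists
  -- Induction on the number of hyperplanes outside `I`. If one of them comes within `(b + 4) r` of
  -- `z`, it joins `I` and `z` moves to the smaller flat, which replaces `b` by `b + A (b + 4)`. The
  -- start is `I = ∅`, `z = y`, `b = 0`. The margin `4` leaves room for a ball of radius `r` about
  -- `y` and a displacement of `z` by `r`.
  have key : ∀ n : ℕ, ∀ b : ℝ, 0 ≤ b → ∃ B : ℝ, 0 < B ∧ ∀ r : ℝ, 0 < r → B * r ≤ 1 → ∀ y : E,
      ∀ I ⊆ H, ∀ z ∈ planeInter I, (H \ I).card ≤ n → ‖y - z‖ ≤ b * r →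
      ∃ I ⊆ H, ∃ z ∈ planeInter I,
      ∃ b : ℝ, 0 ≤ b ∧ b ≤ B ∧ ‖y - z‖ ≤ b * r ∧
        ∀ h ∈ H, h ∉ I → (b + 4) * r ≤ |inner ℝ h.1 z - h.2| := by
    intro n
    induction n with
    | zero =>
      intro b hb
      refine ⟨b + 1, by linarith, fun r hr _ y I hI z hz hc hyz => ⟨I, hI, z, hz, b, hb,
        by linarith, hyz, fun h hh hhI => ?_⟩⟩
      rw [Nat.le_zero, Finset.card_eq_zero, Finset.sdiff_eq_empty_iff_subset] at hc
      exact absurd (hc hh) hhI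
    | succ n ih =>
      intro b hb
      have hb' : 0 ≤ b + A * (b + 4) := by positivity
      obtain ⟨B', hB', h'⟩ := ih (b + A * (b + 4)) hb'
      refine ⟨B' + b + A * (b + 4), by positivity, fun r hr hBr y I hI z hz hc hyz => ?_⟩
      by_cases hex : ∃ h ∈ H, h ∉ I ∧ |inner ℝ h.1 z - h.2| < (b + 4) * r
      · obtain ⟨h, hh, hhI, hlt⟩ := hex
        have hB'r : B' * r ≤ 1 := by
          have : 0 ≤ (b + A * (b + 4)) * r := by positivity
          nlinarith
        have hAr : A * ((b + 4) * r) ≤ 1 := by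
          have : 0 ≤ (B' + b) * r := by positivity
          nlinarith
        have hI' : insert h I ⊆ H := Finset.insert_subset hh hI
        obtain ⟨z', hz', hzz'⟩ := hA (insert h I) (Finset.mem_powerset.2 hI') z ((b + 4) * r)
          (by positivity) hAr (by
            intro k hk
            rcases Finset.mem_insert.1 hk with rfl | hk
            · exact hlt.le
            · rw [hz k hk, sub_self, abs_zero]; positivity)
        obtain ⟨J, hJ, w, hw, b', hb'0, hb'B, h1, h2⟩ := h' r hr hB'r y (insert h I) hI' z' hz' (by
            have h3 : H \ insert h I ⊂ H \ I := by
              refine Finset.ssubset_iff_of_subset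
                (Finset.sdiff_subset_sdiff subset_rfl (Finset.subset_insert _ _)) |>.2
                ⟨h, by simp [hh, hhI], by simp⟩
            have := Finset.card_lt_card h3
            omega) (by
            calc ‖y - z'‖ ≤ ‖y - z‖ + ‖z - z'‖ := norm_sub_le_norm_sub_add_norm_sub _ _ _
              _ ≤ b * r + A * ((b + 4) * r) := add_le_add hyz hzz'
              _ = (b + A * (b + 4)) * r := by ring)
        exact ⟨J, hJ, w, hw, b', hb'0, by linarith, h1, h2⟩
      · push Not at hex
        exact ⟨I, hI, z, hz, b, hb, by linarith [mul_nonneg hA0.le (by linarith : 0 ≤ b + 4)],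
          hyz, fun k hk hkI => hex k hk hkI⟩
  obtain ⟨B, hB, h⟩ := key H.card 0 le_rfl
  refine ⟨B, hB, fun r hr hBr y => ?_⟩
  exact h r hr hBr y ∅ (Finset.empty_subset _) y (fun _ h => absurd h (Finset.notMem_empty _))
    (by simp) (by simp)

end Hyperplanes

/-! ### Local conical structure of arranged sets -/

/-- The directions parallel to all hyperplanes of `I`. -/
def planeDirection {E : Type*} [NormedAddCommGroup E] [InnerProductSpace ℝ E]
    (I : Finset (E × ℝ)) : Submodule ℝ E where
  carrier := {w | ∀ h ∈ I, inner ℝ h.1 w = 0}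
  add_mem' ha hb h hh := by rw [inner_add_right, ha h hh, hb h hh, add_zero]
  zero_mem' h _ := inner_zero_right _
  smul_mem' c x hx h hh := by rw [inner_smul_right, hx h hh, mul_zero]

/-- The closed set `P` is, up to closure, a union of cells of the arrangement `H` of hyperplanes
given by unit normals. -/
structure IsArranged {E : Type*} [NormedAddCommGroup E] [InnerProductSpace ℝ E]
    (P : Set E) (H : Finset (E × ℝ)) : Prop where
  isClosed : IsClosed P
  unit : ∀ h ∈ H, ‖h.1‖ = 1
  frontier_subset : frontier P ⊆ planeUnion H
  subset_closure : P ⊆ closure (P \ planeUnion H)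

namespace IsArranged

variable {E : Type*} [NormedAddCommGroup E] [InnerProductSpace ℝ E] {P : Set E}
  {H I : Finset (E × ℝ)}

/-- `C` misses the frontier of `P`, so it is a connected set covered by the disjoint open sets
`interior P` and `Pᶜ`. -/
theorem subset_of_convex (hP : IsArranged P H) {C : Set E} (hC : Convex ℝ C)
    (hCH : Disjoint C (planeUnion H)) (hne : (C ∩ P).Nonempty) : C ⊆ P := by
  have hint : ∀ x ∈ C, x ∈ P → x ∈ interior P := by
    intro x hx hxP
    by_contra h
    exact hCH.le_bot ⟨hx, hP.frontier_subset ⟨_root_.subset_closure hxP, h⟩⟩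
  have hsub : C ⊆ interior P ∪ Pᶜ := by
    intro x hx
    by_cases h : x ∈ P
    · exact Or.inl (hint x hx h)
    · exact Or.inr h
  obtain ⟨x, hxC, hxP⟩ := hne
  exact (hC.isPreconnected.subset_left_of_subset_union isOpen_interior hP.isClosed.isOpen_compl
    (disjoint_compl_right.mono_left interior_subset) hsub ⟨x, hxC, hint x hxC hxP⟩).trans
      interior_subset

/-- For a unit normal, `|⟪n, z⟫ - c|` is the distance from `z` to the hyperplane, so only
hyperplanes of `I` can meet the ball. -/
theorem mem_of_mem_plane (hP : IsArranged P H) {z x : E} {R : ℝ}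
    (hR : ∀ h ∈ H, h ∉ I → R ≤ |inner ℝ h.1 z - h.2|) (hx : x ∈ Metric.ball z R)
    {h : E × ℝ} (hh : h ∈ H) (hhx : inner ℝ h.1 x = h.2) : h ∈ I := by
  by_contra hI
  have h1 := hR h hh hI
  rw [← hhx, ← inner_sub_right] at h1
  have h2 := abs_real_inner_le_norm h.1 (z - x)
  rw [hP.unit h hh, one_mul, ← dist_eq_norm, dist_comm] at h2
  have h3 := Metric.mem_ball.1 hx
  linarith

/-- Near a point of a flat, away from the other hyperplanes, `P` is a cone. -/
theorem homothety_mem (hP : IsArranged P H) {z x : E} {R t : ℝ} (hz : z ∈ planeInter I)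
    (hR : ∀ h ∈ H, h ∉ I → R ≤ |inner ℝ h.1 z - h.2|) (hx : x ∈ Metric.ball z R) (ht : 0 < t)
    (htx : z + t • (x - z) ∈ Metric.ball z R) (hxP : x ∈ P) : z + t • (x - z) ∈ P := by
  let φ : E → E := fun g => z + t • (g - z)
  have hφ : Continuous φ := by fun_prop
  let N : Set E := Metric.ball z R ∩ φ ⁻¹' Metric.ball z R
  have hN : IsOpen N := Metric.isOpen_ball.inter (Metric.isOpen_ball.preimage hφ)
  have hxN : x ∈ closure (N ∩ (P \ planeUnion H)) :=
    hN.inter_closure ⟨⟨hx, htx⟩, hP.subset_closure hxP⟩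
  -- The segment from `g` to `φ g` stays in the ball, where only hyperplanes through `z` occur. Its
  -- points are homothetic to `g` about `z` with ratio `a + b t > 0`, so such a hyperplane would
  -- contain `g` itself. Hence the segment lies in one cell; general `x` follows by closure.
  have hmap : MapsTo φ (N ∩ (P \ planeUnion H)) P := by
    rintro g ⟨⟨hg1, hg2⟩, hgP, hgU⟩
    refine hP.subset_of_convex (C := segment ℝ g (φ g)) (convex_segment _ _) ?_
      ⟨g, left_mem_segment ℝ _ _, hgP⟩ (right_mem_segment ℝ _ _)
    rw [Set.disjoint_left]
    rintro q hq ⟨h, hh, hhq⟩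
    have hqR : q ∈ Metric.ball z R := (convex_ball z R).segment_subset hg1 hg2 hq
    have hhI := hP.mem_of_mem_plane hR hqR hh hhq
    obtain ⟨a, b, ha, hb, hab, rfl⟩ := hq
    apply hgU
    refine ⟨h, hh, ?_⟩
    have hzh := hz h hhI
    simp only [φ, inner_add_right, inner_smul_right, inner_sub_right, hzh] at hhq
    have hpos : 0 < a + b * t := by
      rcases ha.eq_or_lt with rfl | ha'
      · have : b = 1 := by linarith
        subst this; linarith
      · positivity
    have : (a + b * t) * (inner ℝ h.1 g - h.2) = 0 := by
      linear_combination hhq - h.2 * hab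
    rcases mul_eq_zero.1 this with h0 | h0
    · linarith
    · linarith
  have := map_mem_closure hφ hxN hmap
  rwa [hP.isClosed.closure_eq] at this

theorem homothety_mem_iff (hP : IsArranged P H) {z x : E} {R t : ℝ} (hz : z ∈ planeInter I)
    (hR : ∀ h ∈ H, h ∉ I → R ≤ |inner ℝ h.1 z - h.2|) (hx : x ∈ Metric.ball z R) (ht : 0 < t)
    (htx : z + t • (x - z) ∈ Metric.ball z R) : z + t • (x - z) ∈ P ↔ x ∈ P := by
  refine ⟨fun h => ?_, hP.homothety_mem hz hR hx ht htx⟩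
  have e : z + t⁻¹ • (z + t • (x - z) - z) = x := by
    rw [add_sub_cancel_left, smul_smul, inv_mul_cancel₀ ht.ne', one_smul, add_sub_cancel]
  have := hP.homothety_mem hz hR htx (inv_pos.2 ht) (by rwa [e]) h
  rwa [e] at this

theorem homothety_mem_ball {z x : E} {R t : ℝ} (hx : x ∈ Metric.ball z R) (ht : 0 < t)
    (ht1 : t ≤ 1) : z + t • (x - z) ∈ Metric.ball z R := by
  rw [mem_ball_iff_norm] at hx ⊢
  rw [add_sub_cancel_left, norm_smul, Real.norm_of_nonneg ht.le]
  nlinarith [norm_nonneg (x - z)]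

theorem exists_homothety_mem_ball {z x : E} {ρ : ℝ} (hρ : 0 < ρ) :
    ∃ t : ℝ, 0 < t ∧ t ≤ 1 ∧ z + t • (x - z) ∈ Metric.ball z ρ := by
  have h1 : Tendsto (fun t : ℝ => z + t • (x - z)) (𝓝[>] 0) (𝓝 z) := by
    have : Tendsto (fun t : ℝ => z + t • (x - z)) (𝓝 0) (𝓝 (z + (0 : ℝ) • (x - z))) :=
      Continuous.tendsto (by fun_prop) 0
    rw [zero_smul, add_zero] at this
    exact this.mono_left nhdsWithin_le_nhds
  obtain ⟨t, ht, ht'⟩ := ((h1.eventually (Metric.ball_mem_nhds z hρ)).and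
    (Ioc_mem_nhdsGT (zero_lt_one' ℝ))).exists
  exact ⟨t, ht'.1, ht'.2, ht⟩

theorem apex_mem (hP : IsArranged P H) {z x : E} {R : ℝ} (hz : z ∈ planeInter I)
    (hR : ∀ h ∈ H, h ∉ I → R ≤ |inner ℝ h.1 z - h.2|) (hx : x ∈ Metric.ball z R) (hxP : x ∈ P) :
    z ∈ P := by
  rw [← hP.isClosed.closure_eq, Metric.mem_closure_iff]
  intro ρ hρ
  obtain ⟨t, ht, ht1, htρ⟩ := exists_homothety_mem_ball (z := z) (x := x) hρ
  exact ⟨_, hP.homothety_mem hz hR hx ht (homothety_mem_ball hx ht ht1) hxP,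
    by rw [dist_comm]; exact htρ⟩

theorem ball_subset_of_empty (hP : IsArranged P H) {z y : E} {R r : ℝ}
    (hR : ∀ h ∈ H, h ∉ (∅ : Finset (E × ℝ)) → R ≤ |inner ℝ h.1 z - h.2|) (hr : 0 < r)
    (hsub : Metric.ball y r ⊆ Metric.ball z R) (hy : y ∈ P) : Metric.ball y r ⊆ P := by
  refine hP.subset_of_convex (convex_ball y r) ?_ ⟨y, Metric.mem_ball_self hr, hy⟩
  rw [Set.disjoint_left]
  rintro x hx ⟨h, hh, hhx⟩
  exact Finset.notMem_empty _ (hP.mem_of_mem_plane hR (hsub hx) hh hhx)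

/-- All members of `I` describe the same plane, so the open half-ball on one side meets no
hyperplane of `H` and lies in `P` as soon as it meets `P`. Closedness of `P` adds the bounding
plane. -/
theorem halfspace_inter_ball_subset (hP : IsArranged P H) {z y m : E} {R d : ℝ} (hm : ‖m‖ = 1)
    (hI : ∀ h ∈ I, (h.1 = m ∧ h.2 = d) ∨ (h.1 = -m ∧ h.2 = -d))
    (hR : ∀ h ∈ H, h ∉ I → R ≤ |inner ℝ h.1 z - h.2|) (hy : y ∈ Metric.ball z R)
    (hyc : y ∈ closure ((P \ planeUnion H) ∩ {x | d < inner ℝ m x})) :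
    {x | d ≤ inner ℝ m x} ∩ Metric.ball z R ⊆ P ∧ d ≤ inner ℝ m y := by
  have hO : Metric.ball z R ∩ {x | d < inner ℝ m x} ⊆ P := by
    apply hP.subset_of_convex
    · exact (convex_ball z R).inter
        (convex_halfSpace_gt (f := fun y => inner ℝ m y) (innerₗ E m).isLinear d)
    · rw [Set.disjoint_left]
      rintro x ⟨hx, hxd⟩ ⟨h, hh, hhx⟩
      have hxd' : d < inner ℝ m x := hxd
      rcases hI h (hP.mem_of_mem_plane hR hx hh hhx) with ⟨h1, h2⟩ | ⟨h1, h2⟩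
      · rw [h1, h2] at hhx; linarith
      · rw [h1, h2, inner_neg_left] at hhx; linarith
    · obtain ⟨g, hg, hg'⟩ := mem_closure_iff.1 hyc _ Metric.isOpen_ball hy
      exact ⟨g, ⟨hg, hg'.2⟩, hg'.1.1⟩
  constructor
  · rintro x ⟨hxd, hx⟩
    have hxc : x ∈ closure {x | d < inner ℝ m x} := by
      rw [mem_closure_iff_seq_limit]
      refine ⟨fun k : ℕ => x + ((1 : ℝ) / (k + 1)) • m, fun k => ?_, ?_⟩
      · have hk : (0 : ℝ) < 1 / (k + 1) := by positivity
        have hxd' : d ≤ inner ℝ m x := hxd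
        simp only [mem_ofPred_eq, inner_add_right, inner_smul_right,
          real_inner_self_eq_norm_sq, hm]
        linarith
      · have := (tendsto_one_div_add_atTop_nhds_zero_nat (𝕜 := ℝ)).smul_const m
        simpa using this.const_add x
    have := Metric.isOpen_ball.inter_closure ⟨hx, hxc⟩
    exact hP.isClosed.closure_subset_iff.2 hO this
  · have h1 : y ∈ closure {x | d ≤ inner ℝ m x} :=
      closure_mono (fun x hx => le_of_lt (show d < inner ℝ m x from hx.2)) hyc
    rwa [(isClosed_le (by fun_prop) (by fun_prop)).closure_eq] at h1

/-- `y` is a limit of points of `P` off the hyperplanes, hence of such points on one fixed side of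
the common plane. -/
theorem exists_halfspace (hP : IsArranged P H) (hIH : I ⊆ H) {z y : E} {R : ℝ}
    (hz : z ∈ planeInter I) {h₀ : E × ℝ} (hh₀ : h₀ ∈ I)
    (hI : ∀ h ∈ I, h.1 = h₀.1 ∨ h.1 = -h₀.1)
    (hR : ∀ h ∈ H, h ∉ I → R ≤ |inner ℝ h.1 z - h.2|) (hy : y ∈ Metric.ball z R) (hyP : y ∈ P) :
    ∃ m : E, ∃ d : ℝ, ‖m‖ = 1 ∧ {x | d ≤ inner ℝ m x} ∩ Metric.ball z R ⊆ P ∧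
      d ≤ inner ℝ m y := by
  have hI' : ∀ h ∈ I, (h.1 = h₀.1 ∧ h.2 = h₀.2) ∨ (h.1 = -h₀.1 ∧ h.2 = -h₀.2) := by
    intro h hh
    rcases hI h hh with h1 | h1
    · refine Or.inl ⟨h1, ?_⟩
      rw [← hz h hh, h1, hz h₀ hh₀]
    · refine Or.inr ⟨h1, ?_⟩
      rw [← hz h hh, h1, inner_neg_left, hz h₀ hh₀]
  have hI'' : ∀ h ∈ I, (h.1 = -h₀.1 ∧ h.2 = -h₀.2) ∨ (h.1 = - -h₀.1 ∧ h.2 = - -h₀.2) := by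
    simpa only [neg_neg, or_comm] using hI'
  have hsplit : P \ planeUnion H ⊆ ((P \ planeUnion H) ∩ {x | h₀.2 < inner ℝ h₀.1 x}) ∪
      ((P \ planeUnion H) ∩ {x | -h₀.2 < inner ℝ (-h₀.1) x}) := by
    intro x hx
    have hne : inner ℝ h₀.1 x ≠ h₀.2 := fun h => hx.2 ⟨h₀, hIH hh₀, h⟩
    rcases lt_or_gt_of_ne hne with h | h
    · refine Or.inr ⟨hx, ?_⟩
      simp only [mem_ofPred_eq, inner_neg_left]
      linarith
    · exact Or.inl ⟨hx, h⟩
  have hyc := closure_mono hsplit (hP.subset_closure hyP)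
  rw [closure_union] at hyc
  have hu := hP.unit h₀ (hIH hh₀)
  rcases hyc with h | h
  · exact ⟨h₀.1, h₀.2, hu, hP.halfspace_inter_ball_subset hu hI' hR hy h⟩
  · have hu' : ‖-h₀.1‖ = 1 := by rwa [norm_neg]
    exact ⟨-h₀.1, -h₀.2, hu', hP.halfspace_inter_ball_subset hu' hI'' hR hy h⟩

end IsArranged

/-! ### Lower volume bounds by dimension of the flat -/

section Volume

variable {P : Set (EuclideanSpace ℝ (Fin 3))}
  {H I : Finset (EuclideanSpace ℝ (Fin 3) × ℝ)}

theorem exists_unit_orthogonal (m : EuclideanSpace ℝ (Fin 3)) :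
    ∃ u : EuclideanSpace ℝ (Fin 3), ‖u‖ = 1 ∧ inner ℝ u m = 0 := by
  have hne : (ℝ ∙ m)ᗮ ≠ ⊥ := by
    intro h
    have h1 := Submodule.finrank_add_finrank_orthogonal (ℝ ∙ m)
    have h2 : Module.finrank ℝ (ℝ ∙ m) ≤ 1 := by
      simpa using finrank_span_le_card (R := ℝ) ({m} : Set (EuclideanSpace ℝ (Fin 3)))
    rw [h, finrank_bot, finrank_euclideanSpace_fin] at h1
    omega
  obtain ⟨w, hw, hw0⟩ := Submodule.exists_mem_ne_zero_of_ne_bot hne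
  refine ⟨‖w‖⁻¹ • w, ?_, ?_⟩
  · rw [norm_smul, norm_inv, norm_norm, inv_mul_cancel₀ (norm_ne_zero_iff.2 hw0)]
  · rw [inner_smul_left, real_inner_comm, (Submodule.mem_orthogonal_singleton_iff_inner_right).1 hw,
      mul_zero]

theorem measureReal_inter_ball_mono {A B : Set (EuclideanSpace ℝ (Fin 3))}
    {y : EuclideanSpace ℝ (Fin 3)} {r : ℝ} (h : A ∩ Metric.ball y r ⊆ B) :
    volume.real (A ∩ Metric.ball y r) ≤ volume.real (B ∩ Metric.ball y r) :=
  measureReal_mono (subset_inter h inter_subset_right)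
    ((measure_mono inter_subset_right).trans_lt measure_ball_lt_top).ne

theorem volume_ge_of_halfspace {m y : EuclideanSpace ℝ (Fin 3)} {d r : ℝ} (hm : ‖m‖ = 1)
    (hsub : {x | d ≤ inner ℝ m x} ∩ Metric.ball y r ⊆ P) (hy : d ≤ inner ℝ m y) (hr : 0 ≤ r) :
    2 * Real.pi / 3 * r ^ 3 ≤ volume.real (P ∩ Metric.ball y r) := by
  obtain ⟨u, hu, hum⟩ := exists_unit_orthogonal m
  rw [← volume_dihedralWedge_inter_ball Real.pi_pos le_rfl hu hm hum y hr]
  apply measureReal_inter_ball_mono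
  refine subset_trans (inter_subset_inter_left _ ?_) hsub
  intro x hx
  have h1 := ((mem_dihedralWedge_iff Real.pi_pos le_rfl _ _ _ _).1 hx).1
  rw [inner_sub_right] at h1
  change d ≤ inner ℝ m x
  linarith

theorem homothety_mem_dihedralWedge {z u v x : EuclideanSpace ℝ (Fin 3)} {α t : ℝ} (ht : 0 < t)
    (hx : x ∈ dihedralWedge z u v α) : z + t • (x - z) ∈ dihedralWedge z u v α := by
  obtain ⟨s, hs, τ, hτ, h1, h2⟩ := hx
  refine ⟨t * s, by positivity, τ, hτ, ?_, ?_⟩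
  · rw [add_sub_cancel_left, inner_smul_right, h1, mul_assoc]
  · rw [add_sub_cancel_left, inner_smul_right, h2, mul_assoc]

theorem homothety_mem_dihedralWedge_iff {z u v x : EuclideanSpace ℝ (Fin 3)} {α t : ℝ}
    (ht : 0 < t) : z + t • (x - z) ∈ dihedralWedge z u v α ↔ x ∈ dihedralWedge z u v α := by
  refine ⟨fun h => ?_, homothety_mem_dihedralWedge ht⟩
  have := homothety_mem_dihedralWedge (inv_pos.2 ht) h
  rwa [add_sub_cancel_left, smul_smul, inv_mul_cancel₀ ht.ne', one_smul, add_sub_cancel] at this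

/-- The volume bound at points close to a line of the arrangement. -/
theorem volume_ge_of_line (hP : IsArranged P H) {V : Set (EuclideanSpace ℝ (Fin 3))}
    (hV : V.Finite) {κ : ℝ} (hκ : κ ≤ Real.pi)
    (hW : ∀ x ∈ frontier P \ V, ∃ α, 0 < α ∧ κ ≤ α ∧ IsWedgeNear P x α)
    {w z y : EuclideanSpace ℝ (Fin 3)} (hw : w ∈ planeDirection I) (hw0 : w ≠ 0)
    (hz : z ∈ planeInter I) {b r : ℝ} (hr : 0 < r) (hyz : ‖y - z‖ ≤ b * r)
    (hR : ∀ h ∈ H, h ∉ I → (b + 4) * r ≤ |inner ℝ h.1 z - h.2|) (hy : y ∈ P) :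
    2 * κ / 3 * r ^ 3 ≤ volume.real (P ∩ Metric.ball y r) := by
  have hwn : 0 < ‖w‖ := norm_pos_iff.2 hw0
  -- The line through `z` may be an edge and `z` a vertex. Since only finitely many points are
  -- excluded, `z` can be moved along the line by less than `r` to a point `z'` where the wedge
  -- condition is available.
  obtain ⟨s, ⟨hs0, hs1⟩, hsV⟩ : ∃ s ∈ Ioo 0 (r / ‖w‖), z + s • w ∉ V := by
    by_contra! hcon
    have hinj : InjOn (fun s : ℝ => z + s • w) (Ioo 0 (r / ‖w‖)) := by
      intro s _ t _ hst
      exact smul_left_injective ℝ hw0 (add_left_cancel hst)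
    exact (Ioo_infinite (by positivity : 0 < r / ‖w‖))
      (Finite.of_finite_image (hV.subset (image_subset_iff.2 hcon)) hinj)
  set z' := z + s • w with hz'
  have hzz' : ‖z - z'‖ ≤ r := by
    rw [hz', sub_add_cancel_left, norm_neg, norm_smul, Real.norm_of_nonneg hs0.le]
    exact ((lt_div_iff₀ hwn).1 hs1).le
  have hzI : z' ∈ planeInter I := fun h hh => by
    rw [hz', inner_add_right, inner_smul_right, hw h hh, hz h hh, mul_zero, add_zero]
  have hR' : ∀ h ∈ H, h ∉ I → (b + 3) * r ≤ |inner ℝ h.1 z' - h.2| := by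
    intro h hh hhI
    have h1 := hR h hh hhI
    have h2 := abs_real_inner_le_norm h.1 (z - z')
    rw [hP.unit h hh, one_mul, inner_sub_right] at h2
    have h3 := abs_sub_abs_le_abs_sub (inner ℝ h.1 z - h.2) (inner ℝ h.1 z' - h.2)
    rw [sub_sub_sub_cancel_right] at h3
    linarith
  have hyz' : ‖y - z'‖ ≤ (b + 1) * r := by
    have := norm_sub_le_norm_sub_add_norm_sub y z z'
    linarith
  have hyR : y ∈ Metric.ball z' ((b + 3) * r) := by
    rw [mem_ball_iff_norm]; linarith
  have hsub : Metric.ball y r ⊆ Metric.ball z' ((b + 3) * r) := by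
    apply Metric.ball_subset_ball'
    rw [dist_eq_norm]; linarith
  have hscale : ∀ ρ : ℝ, 0 < ρ → ∀ x ∈ Metric.ball z' ((b + 3) * r), ∃ t : ℝ, 0 < t ∧
      z' + t • (x - z') ∈ Metric.ball z' ρ ∧ (z' + t • (x - z') ∈ P ↔ x ∈ P) := by
    intro ρ hρ x hx
    obtain ⟨t, ht, ht1, htρ⟩ := IsArranged.exists_homothety_mem_ball (z := z') (x := x) hρ
    exact ⟨t, ht, htρ, hP.homothety_mem_iff hzI hR' hx ht
      (IsArranged.homothety_mem_ball hx ht ht1)⟩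
  have hz'P : z' ∈ P := hP.apex_mem hzI hR' hyR hy
  have hr3 : 0 < r ^ 3 := by positivity
  by_cases hf : z' ∈ frontier P
  · obtain ⟨α, hα0, hκα, u, v, hu, hv, huv, ρ, hρ, hPW⟩ := hW z' ⟨hf, hsV⟩
    -- `P` (within this ball) and the wedge are both cones about `z'`, so their agreement near `z'`,
    -- at an unknown scale `ρ`, extends to the whole ball.
    have hmem : ∀ x ∈ Metric.ball z' ((b + 3) * r), x ∈ P ↔ x ∈ dihedralWedge z' u v α := by
      intro x hx
      obtain ⟨t, ht, htρ, hiff⟩ := hscale ρ hρ x hx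
      rw [← hiff, ← homothety_mem_dihedralWedge_iff (z := z') (x := x) ht]
      have := Set.ext_iff.1 hPW (z' + t • (x - z'))
      simpa [htρ, -Metric.mem_ball] using this
    have h1 := le_volume_dihedralWedge_inter_ball hα0 hu hv huv ((hmem y hyR).1 hy) hr.le
    have h2 : volume.real (dihedralWedge z' u v α ∩ Metric.ball y r) ≤
        volume.real (P ∩ Metric.ball y r) :=
      measureReal_inter_ball_mono fun x hx => (hmem x (hsub hx.2)).2 hx.1
    have h3 : κ ≤ min α Real.pi := le_min hκα hκ
    nlinarith
  · have hint : z' ∈ interior P := by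
      by_contra h
      exact hf ⟨subset_closure hz'P, h⟩
    obtain ⟨ρ, hρ, hball⟩ := Metric.isOpen_iff.1 isOpen_interior z' hint
    have h1 : univ ∩ Metric.ball y r ⊆ P := by
      rintro x ⟨-, hx⟩
      obtain ⟨t, ht, htρ, hiff⟩ := hscale ρ hρ x (hsub hx)
      exact hiff.1 (interior_subset (hball htρ))
    have h2 := measureReal_inter_ball_mono h1
    rw [univ_inter, volume_real_ball_fin_three y hr.le] at h2
    nlinarith [Real.pi_pos]

/-- The four volume bounds, according to the dimension of the flat. -/
theorem volume_ge_of_finrank (hP : IsArranged P H) {V : Set (EuclideanSpace ℝ (Fin 3))}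
    (hV : V.Finite) {κ : ℝ} (hκ : κ ≤ Real.pi)
    (hW : ∀ x ∈ frontier P \ V, ∃ α, 0 < α ∧ κ ≤ α ∧ IsWedgeNear P x α)
    {z y : EuclideanSpace ℝ (Fin 3)}
    (hIH : I ⊆ H) (hz : z ∈ planeInter I) {b r : ℝ} (hr : 0 < r)
    (hyz : ‖y - z‖ ≤ b * r)
    (hR : ∀ h ∈ H, h ∉ I → (b + 4) * r ≤ |inner ℝ h.1 z - h.2|) (hy : y ∈ P) :
    (Module.finrank ℝ (planeDirection I) = 1 →
      2 * κ / 3 * r ^ 3 ≤ volume.real (P ∩ Metric.ball y r)) ∧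
    (Module.finrank ℝ (planeDirection I) = 2 →
      2 * Real.pi / 3 * r ^ 3 ≤ volume.real (P ∩ Metric.ball y r)) ∧
    (Module.finrank ℝ (planeDirection I) = 3 →
      4 * Real.pi / 3 * r ^ 3 ≤ volume.real (P ∩ Metric.ball y r)) := by
  have hsub : Metric.ball y r ⊆ Metric.ball z ((b + 4) * r) := by
    apply Metric.ball_subset_ball'
    rw [dist_eq_norm]; linarith
  have hempty : Module.finrank ℝ (planeDirection I) = 3 ↔ I = ∅ := by
    constructor
    · intro h
      have htop : planeDirection I = ⊤ :=
        Submodule.eq_top_of_finrank_eq (by rw [h, finrank_euclideanSpace_fin])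
      by_contra hne
      obtain ⟨h₀, hh₀⟩ := Finset.nonempty_iff_ne_empty.2 hne
      have h1 : h₀.1 ∈ planeDirection I := by rw [htop]; trivial
      have h2 := h1 h₀ hh₀
      rw [real_inner_self_eq_norm_sq, hP.unit h₀ (hIH hh₀)] at h2
      norm_num at h2
    · rintro rfl
      have htop : planeDirection (∅ : Finset (EuclideanSpace ℝ (Fin 3) × ℝ)) = ⊤ := by
        rw [eq_top_iff]
        exact fun w _ h hh => absurd hh (Finset.notMem_empty _)
      rw [htop, finrank_top, finrank_euclideanSpace_fin]
  refine ⟨fun hd => ?_, fun hd => ?_, fun hd => ?_⟩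
  · obtain ⟨w, hw, hw0⟩ := Submodule.exists_mem_ne_zero_of_ne_bot
      (p := planeDirection I) (by
        intro h
        rw [h, finrank_bot] at hd
        exact zero_ne_one hd)
    exact volume_ge_of_line hP hV hκ hW hw hw0 hz hr hyz hR hy
  · have hne : I.Nonempty := by
      rw [Finset.nonempty_iff_ne_empty]
      intro h
      have := hempty.2 h
      omega
    obtain ⟨h₀, hh₀⟩ := hne
    -- All normals of `I` lie on this line and are unit vectors, hence agree up to sign.
    have horth : Module.finrank ℝ (planeDirection I)ᗮ = 1 := by
      have := Submodule.finrank_add_finrank_orthogonal (planeDirection I)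
      rw [hd, finrank_euclideanSpace_fin] at this
      omega
    have hmem : ∀ h ∈ I, h.1 ∈ (planeDirection I)ᗮ := by
      intro h hh
      rw [Submodule.mem_orthogonal']
      exact fun w hw => hw h hh
    have hu₀ := hP.unit h₀ (hIH hh₀)
    have hpar : ∀ h ∈ I, h.1 = h₀.1 ∨ h.1 = -h₀.1 := by
      intro h hh
      have hn0 : (⟨h₀.1, hmem h₀ hh₀⟩ : (planeDirection I)ᗮ) ≠ 0 := by
        intro h0
        have : h₀.1 = 0 := congrArg Subtype.val h0
        rw [this, norm_zero] at hu₀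
        exact zero_ne_one hu₀
      obtain ⟨c, hc⟩ := (finrank_eq_one_iff_of_nonzero' _ hn0).1 horth ⟨h.1, hmem h hh⟩
      have hc' : c • h₀.1 = h.1 := congrArg Subtype.val hc
      have hu := hP.unit h (hIH hh)
      rw [← hc', norm_smul, hu₀, mul_one, Real.norm_eq_abs] at hu
      rcases eq_or_eq_neg_of_abs_eq hu with h1 | h1
      · exact Or.inl (by rw [← hc', h1, one_smul])
      · exact Or.inr (by rw [← hc', h1, neg_one_smul])
    obtain ⟨m, d, hm, hmsub, hmd⟩ := hP.exists_halfspace hIH hz hh₀ hpar hR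
      (hsub (Metric.mem_ball_self hr)) hy
    exact volume_ge_of_halfspace hm ((inter_subset_inter_right _ hsub).trans hmsub) hmd hr.le
  · obtain rfl := hempty.1 hd
    rw [← volume_real_ball_fin_three y hr.le, inter_eq_self_of_subset_right
      (hP.ball_subset_of_empty hR hr hsub hy)]

end Volume

/-! ### Polyhedra as arranged sets -/

theorem isCompact_convexHull_finset {E : Type*} [NormedAddCommGroup E] [NormedSpace ℝ E]
    (s : Finset E) : IsCompact (convexHull ℝ (s : Set E)) :=
  s.finite_toSet.isCompact_convexHull ℝ

theorem IsPolyhedron.isCompact {P : Set (EuclideanSpace ℝ (Fin 3))} (hP : IsPolyhedron P) :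
    IsCompact P := by
  obtain ⟨S, hS⟩ := hP.finite_union
  rw [hS]
  exact S.isCompact_biUnion fun s _ => isCompact_convexHull_finset s

/-- The copy of `K` shrunk about `y` by the ratio `r / D`, with `D` exceeding all distances in `K`,
lies in both `K` and the ball. The conclusion for all small `c` allows a common constant for
finitely many polytopes. -/
theorem eventually_volume_ge_of_convex {K : Set (EuclideanSpace ℝ (Fin 3))} (hK : Convex ℝ K)
    (hKc : IsCompact K) (hKi : (interior K).Nonempty) :
    ∀ᶠ c : ℝ in 𝓝[>] 0, ∀ y ∈ K, ∀ r : ℝ, 0 < r → r < c →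
      c * r ^ 3 ≤ volume.real (K ∩ Metric.ball y r) := by
  obtain ⟨D, hD0, hD⟩ : ∃ D : ℝ, 0 < D ∧ ∀ x ∈ K, ∀ y ∈ K, dist x y < D := by
    refine ⟨Metric.diam K + 1, by linarith [Metric.diam_nonneg (s := K)], fun x hx y hy => ?_⟩
    linarith [Metric.dist_le_diam_of_mem hKc.isBounded hx hy]
  have hvol : 0 < volume.real K := by
    rw [measureReal_def]
    refine ENNReal.toReal_pos ?_ hKc.measure_lt_top.ne
    exact ((isOpen_interior.measure_pos volume hKi).trans_le (measure_mono interior_subset)).ne'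
  have hpos : 0 < min D (volume.real K / D ^ 3) := lt_min hD0 (by positivity)
  filter_upwards [Ioo_mem_nhdsGT hpos] with c hc y hy r hr hrc
  have hcD : c < D := hc.2.trans_le (min_le_left _ _)
  have hcv : c < volume.real K / D ^ 3 := hc.2.trans_le (min_le_right _ _)
  have ht0 : 0 < r / D := by positivity
  have ht1 : r / D ≤ 1 := by rw [div_le_one hD0]; linarith
  have hsub : AffineMap.homothety y (r / D) '' K ⊆ K ∩ Metric.ball y r := by
    rintro _ ⟨x, hx, rfl⟩
    constructor
    · rw [AffineMap.homothety_eq_lineMap]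
      exact hK.segment_subset hy hx (by
        rw [segment_eq_image_lineMap]; exact ⟨r / D, ⟨ht0.le, ht1⟩, rfl⟩)
    · rw [Metric.mem_ball, dist_homothety_center, Real.norm_of_nonneg ht0.le, dist_comm]
      rw [div_mul_eq_mul_div, div_lt_iff₀ hD0]
      exact mul_lt_mul_of_pos_left (hD x hx y hy) hr
  have h1 : volume.real (AffineMap.homothety y (r / D) '' K) = (r / D) ^ 3 * volume.real K := by
    rw [measureReal_def, Measure.addHaar_image_homothety, finrank_euclideanSpace_fin,
      ENNReal.toReal_mul, ENNReal.toReal_ofReal (abs_nonneg _), abs_of_nonneg (by positivity)]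
    rfl
  have h2 : volume.real (AffineMap.homothety y (r / D) '' K) ≤ volume.real (K ∩ Metric.ball y r) :=
    measureReal_mono hsub ((measure_mono inter_subset_right).trans_lt measure_ball_lt_top).ne
  rw [h1, div_pow] at h2
  refine le_trans ?_ h2
  rw [div_mul_eq_mul_div, mul_div_assoc, mul_comm]
  exact mul_le_mul_of_nonneg_left hcv.le (by positivity)

/-- A frontier point of `P` is interior to none of the constituent polytopes, so the hyperplanes
from `exists_planes` contain it. The crude constant `c` is all that is needed near vertices. -/
theorem IsPolyhedron.exists_isArranged {P : Set (EuclideanSpace ℝ (Fin 3))}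
    (hP : IsPolyhedron P) :
    ∃ H, IsArranged P H ∧ ∃ c : ℝ, 0 < c ∧ ∀ y ∈ P, ∀ r : ℝ, 0 < r → r < c →
      c * r ^ 3 ≤ volume.real (P ∩ Metric.ball y r) := by
  classical
  obtain ⟨S, hS⟩ := hP.finite_union
  obtain ⟨H, hH1, hH⟩ := exists_planes S
  have hcl := hP.isCompact.isClosed
  have hmemP : ∀ s ∈ S, convexHull ℝ (s : Set (EuclideanSpace ℝ (Fin 3))) ⊆ P := by
    intro s hs
    rw [hS]
    exact subset_biUnion_of_mem (u := fun s : Finset (EuclideanSpace ℝ (Fin 3)) =>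
      convexHull ℝ (s : Set (EuclideanSpace ℝ (Fin 3)))) hs
  have hmem : ∀ x ∈ P, ∃ s ∈ S, x ∈ convexHull ℝ (s : Set (EuclideanSpace ℝ (Fin 3))) := by
    intro x hx
    rw [hS] at hx
    simpa using hx
  have hA : IsArranged P H := by
    refine ⟨hcl, hH1, ?_, ?_⟩
    · rintro x ⟨hx, hxi⟩
      rw [hcl.closure_eq] at hx
      obtain ⟨s, hs, hxs⟩ := hmem x hx
      exact hH s hs x hxs fun h => hxi (interior_mono (hmemP s hs) h)
    · have h1 := (dense_compl_planeUnion hH1).open_subset_closure_inter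
        (isOpen_interior (s := P))
      have h2 : closure (interior P) ⊆ closure (P \ planeUnion H) := by
        refine closure_minimal (h1.trans (closure_mono ?_)) isClosed_closure
        exact fun x hx => ⟨interior_subset hx.1, hx.2⟩
      rwa [hP.solid] at h2
  refine ⟨H, hA, ?_⟩
  set S' := S.filter fun s : Finset (EuclideanSpace ℝ (Fin 3)) =>
    (interior (convexHull ℝ (s : Set (EuclideanSpace ℝ (Fin 3))))).Nonempty with hS'
  have hev : ∀ᶠ c : ℝ in 𝓝[>] 0, ∀ s ∈ S',
      ∀ y ∈ convexHull ℝ (s : Set (EuclideanSpace ℝ (Fin 3))), ∀ r : ℝ, 0 < r → r < c →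
      c * r ^ 3 ≤ volume.real
        (convexHull ℝ (s : Set (EuclideanSpace ℝ (Fin 3))) ∩ Metric.ball y r) := by
    refine (Filter.eventually_all_finset S').2 fun s hs => ?_
    exact eventually_volume_ge_of_convex (convex_convexHull ℝ _) (isCompact_convexHull_finset s)
      (Finset.mem_filter.1 hs).2
  obtain ⟨c, hc, hc0⟩ := (hev.and self_mem_nhdsWithin).exists
  refine ⟨c, hc0, fun y hy r hr hrc => ?_⟩
  -- Polytopes without interior can be dropped: a point of `P` off the hyperplanes is interior to a
  -- polytope containing it, and these points are dense in `P`.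
  have hcover : P ⊆ ⋃ s ∈ S', convexHull ℝ (s : Set (EuclideanSpace ℝ (Fin 3))) := by
    refine hA.subset_closure.trans (closure_minimal ?_
      (isClosed_biUnion_finset fun s _ => (isCompact_convexHull_finset s).isClosed))
    rintro x ⟨hx, hxU⟩
    obtain ⟨s, hs, hxs⟩ := hmem x hx
    have hxi : x ∈ interior (convexHull ℝ (s : Set (EuclideanSpace ℝ (Fin 3)))) := by
      by_contra h
      exact hxU (hH s hs x hxs h)
    exact mem_biUnion (Finset.mem_filter.2 ⟨hs, ⟨x, hxi⟩⟩) hxs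
  obtain ⟨s, hs, hys⟩ : ∃ s ∈ S', y ∈ convexHull ℝ (s : Set (EuclideanSpace ℝ (Fin 3))) := by
    simpa using hcover hy
  exact (hc s hs y hys r hr hrc).trans (measureReal_inter_ball_mono
    (inter_subset_left.trans (hmemP s (Finset.mem_filter.1 hs).1)))

/-! ### Nets adapted to the flats -/

/-- A ball in a `k`-dimensional space is covered by `O(r ^ (-k))` balls of radius `r`. -/
theorem exists_finset_cover {D : Type*} [NormedAddCommGroup D] [NormedSpace ℝ D]
    [FiniteDimensional ℝ D] (R : ℝ) :
    ∃ C : ℝ, 0 < C ∧ ∀ r : ℝ, 0 < r → r ≤ 1 → ∃ t : Finset D,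
      (t.card : ℝ) ≤ C * (1 / r) ^ Module.finrank ℝ D ∧
      ∀ x : D, ‖x‖ ≤ R → ∃ q ∈ t, ‖x - q‖ ≤ r := by
  classical
  set k := Module.finrank ℝ D with hk
  let L : D ≃L[ℝ] (Fin k → ℝ) := ContinuousLinearEquiv.ofFinrankEq (by simp [hk])
  set M : ℝ := ‖(L : D →L[ℝ] (Fin k → ℝ))‖ + 1 with hM
  set M' : ℝ := ‖(L.symm : (Fin k → ℝ) →L[ℝ] D)‖ + 1 with hM'
  have hM0 : 0 < M := by positivity
  have hM'0 : 0 < M' := by positivity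
  set Q : ℝ := M * |R| * M' with hQ
  have hQ0 : 0 ≤ Q := by positivity
  -- A grid of mesh `s = r / M'` in coordinates. With `m ≤ Q / r + 2` and `r ≤ 1`, the `2 m + 1`
  -- values per coordinate number at most `(2 Q + 5) / r`. The extra `+ 1` in `m` accommodates
  -- rounding down by `⌊·⌋`.
  refine ⟨(2 * Q + 5) ^ k, by positivity, fun r hr hr1 => ?_⟩
  set s := r / M' with hs
  have hs0 : 0 < s := by positivity
  set m : ℕ := ⌈M * |R| / s⌉₊ + 1 with hm
  have hm1 : M * |R| / s ≤ m - 1 := by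
    rw [hm]; push_cast; rw [add_sub_cancel_right]; exact Nat.le_ceil _
  have hm2 : (m : ℝ) ≤ Q / r + 2 := by
    have h1 : (⌈M * |R| / s⌉₊ : ℝ) < M * |R| / s + 1 := Nat.ceil_lt_add_one (by positivity)
    have h2 : M * |R| / s = Q / r := by rw [hs, hQ]; field_simp
    rw [hm]; push_cast; linarith
  refine ⟨(Fintype.piFinset fun _ : Fin k => Finset.Icc (-(m : ℤ)) m).image
    (fun g => L.symm (fun i => s * (g i : ℝ))), ?_, ?_⟩
  · have hcard : (Finset.Icc (-(m : ℤ)) m).card = 2 * m + 1 := by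
      rw [Int.card_Icc]; omega
    calc _ ≤ (((Fintype.piFinset fun _ : Fin k => Finset.Icc (-(m : ℤ)) m).card : ℕ) : ℝ) := by
          exact_mod_cast Finset.card_image_le
      _ = (2 * m + 1 : ℝ) ^ k := by
          rw [Fintype.card_piFinset_const, hcard]; push_cast; rfl
      _ ≤ ((2 * Q + 5) * (1 / r)) ^ k := by
          apply pow_le_pow_left₀ (by positivity)
          have h1 : 1 ≤ 1 / r := by rw [le_div_iff₀ hr]; linarith
          have h2 : Q / r = Q * (1 / r) := by ring
          rw [h2] at hm2
          linarith
      _ = _ := by rw [mul_pow]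
  · intro x hx
    let g : Fin k → ℤ := fun i => ⌊L x i / s⌋
    have hLx : ∀ i, |L x i| ≤ M * |R| := by
      intro i
      calc |L x i| ≤ ‖L x‖ := norm_le_pi_norm (L x) i
        _ ≤ ‖(L : D →L[ℝ] (Fin k → ℝ))‖ * ‖x‖ := (L : D →L[ℝ] (Fin k → ℝ)).le_opNorm x
        _ ≤ M * |R| := by
          apply mul_le_mul (by rw [hM]; linarith) (hx.trans (le_abs_self R)) (norm_nonneg _) hM0.le
    refine ⟨L.symm (fun i => s * (g i : ℝ)), Finset.mem_image_of_mem _ ?_, ?_⟩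
    · rw [Fintype.mem_piFinset]
      intro i
      have h1 : |L x i / s| ≤ m - 1 := by
        rw [abs_div, abs_of_pos hs0]
        exact (div_le_div_of_nonneg_right (hLx i) hs0.le).trans hm1
      obtain ⟨h2, h3⟩ := abs_le.1 h1
      have h4 := Int.floor_le (L x i / s)
      have h5 := Int.lt_floor_add_one (L x i / s)
      rw [Finset.mem_Icc]
      constructor
      · have : (-(m : ℤ) : ℝ) ≤ (⌊L x i / s⌋ : ℝ) := by push_cast; linarith
        exact_mod_cast this
      · have : (⌊L x i / s⌋ : ℝ) ≤ (m : ℤ) := by push_cast; linarith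
        exact_mod_cast this
    · have h1 : x - L.symm (fun i => s * (g i : ℝ)) = L.symm (L x - fun i => s * (g i : ℝ)) := by
        rw [map_sub, L.symm_apply_apply]
      rw [h1]
      have h2 : ‖L x - fun i => s * (g i : ℝ)‖ ≤ s := by
        rw [pi_norm_le_iff_of_nonneg hs0.le]
        intro i
        have h4 := Int.floor_le (L x i / s)
        have h5 := Int.lt_floor_add_one (L x i / s)
        rw [le_div_iff₀ hs0] at h4
        rw [div_lt_iff₀ hs0] at h5
        rw [Pi.sub_apply, Real.norm_eq_abs, abs_le]
        simp only [g]
        constructor <;> linarith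
      calc _ ≤ ‖(L.symm : (Fin k → ℝ) →L[ℝ] D)‖ * ‖L x - fun i => s * (g i : ℝ)‖ :=
            (L.symm : (Fin k → ℝ) →L[ℝ] D).le_opNorm _
        _ ≤ M' * s := by
          apply mul_le_mul (by rw [hM']; linarith) h2 (norm_nonneg _) hM'0.le
        _ = r := by rw [hs]; field_simp

/-- Each useful centre is replaced by a point of `T` near it, at the cost of doubling the distance.
Centres must belong to `T` because the volume bounds hold only there. -/
theorem exists_finset_subset_cover {X : Type*} [PseudoMetricSpace X] {T : Set X} {c : Finset X}
    {δ : ℝ} (hc : ∀ y ∈ T, ∃ q ∈ c, dist y q ≤ δ) :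
    ∃ t : Finset X, t.card ≤ c.card ∧ (∀ q ∈ t, q ∈ T) ∧ ∀ y ∈ T, ∃ q ∈ t, dist y q ≤ 2 * δ := by
  classical
  have : ∀ q : X, ∃ p : X, (∃ y ∈ T, dist y q ≤ δ) → p ∈ T ∧ dist p q ≤ δ := by
    intro q
    by_cases h : ∃ y ∈ T, dist y q ≤ δ
    · obtain ⟨y, hy⟩ := h
      exact ⟨y, fun _ => hy⟩
    · exact ⟨q, fun h' => absurd h' h⟩
  choose g hg using this
  refine ⟨(c.image g).filter (· ∈ T), (Finset.card_filter_le _ _).trans Finset.card_image_le,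
    fun q hq => (Finset.mem_filter.1 hq).2, fun y hy => ?_⟩
  obtain ⟨q, hq, hyq⟩ := hc y hy
  obtain ⟨h1, h2⟩ := hg q ⟨y, hy, hyq⟩
  refine ⟨g q, Finset.mem_filter.2 ⟨Finset.mem_image_of_mem _ hq, h1⟩, ?_⟩
  have := dist_triangle_right y (g q) q
  linarith

/-- An `r`-net of the flat is combined with the `r`-fold of one fixed `ε`-net of a ball of radius `B
+ 1`. The latter has size independent of `r`, so only the dimension of the flat enters the exponent.
-/
theorem exists_finset_cover_planeInter {E : Type*} [NormedAddCommGroup E] [InnerProductSpace ℝ E]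
    [FiniteDimensional ℝ E] (I : Finset (E × ℝ)) (R B : ℝ) {ε : ℝ} (hε : 0 < ε) :
    ∃ C : ℝ, 0 < C ∧ ∀ r : ℝ, 0 < r → r ≤ 1 → ∃ t : Finset E,
      (t.card : ℝ) ≤ C * (1 / r) ^ Module.finrank ℝ (planeDirection I) ∧
      ∀ z ∈ planeInter I, ‖z‖ ≤ R → ∀ y, ‖y - z‖ ≤ B * r → ∃ q ∈ t, dist y q ≤ ε * r := by
  classical
  rcases (planeInter I).eq_empty_or_nonempty with he | ⟨z₀, hz₀⟩
  · refine ⟨1, one_pos, fun r hr _ => ⟨∅, ?_, ?_⟩⟩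
    · simp only [Finset.card_empty, Nat.cast_zero]; positivity
    · intro z hz; rw [he] at hz; exact absurd hz (notMem_empty z)
  · obtain ⟨C₀, hC₀, h₀⟩ := exists_finset_cover (D := planeDirection I) (R + ‖z₀‖)
    obtain ⟨C₁, hC₁, h₁⟩ := exists_finset_cover (D := E) (B + 1)
    obtain ⟨t₁, -, ht₁⟩ := h₁ (min ε 1) (lt_min hε one_pos) (min_le_right _ _)
    refine ⟨C₀ * (t₁.card + 1), by positivity, fun r hr hr1 => ?_⟩
    obtain ⟨t₀, ht₀c, ht₀⟩ := h₀ r hr hr1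
    refine ⟨(t₀ ×ˢ t₁).image fun p => z₀ + (p.1 : E) + r • p.2, ?_, ?_⟩
    · calc _ ≤ (((t₀ ×ˢ t₁).card : ℕ) : ℝ) := by exact_mod_cast Finset.card_image_le
        _ = t₀.card * t₁.card := by rw [Finset.card_product]; push_cast; rfl
        _ ≤ (C₀ * (1 / r) ^ Module.finrank ℝ (planeDirection I)) * (t₁.card + 1) :=
            mul_le_mul ht₀c (by linarith) (by positivity) (by positivity)
        _ = _ := by ring
    · intro z hz hzR y hyz
      have hdir : z - z₀ ∈ planeDirection I := fun h hh => by
        rw [inner_sub_right, hz h hh, hz₀ h hh, sub_self]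
      obtain ⟨q, hq, hzq⟩ := ht₀ ⟨z - z₀, hdir⟩
        ((norm_sub_le z z₀).trans (by linarith))
      have hzq' : ‖z - z₀ - q‖ ≤ r := hzq
      have h2 : ‖y - (z₀ + q)‖ ≤ (B + 1) * r := by
        have e : y - (z₀ + q) = (y - z) + (z - z₀ - q) := by abel
        rw [e]
        refine (norm_add_le _ _).trans ?_
        linarith
      obtain ⟨e, he, hye⟩ := ht₁ (r⁻¹ • (y - (z₀ + q))) (by
        rw [norm_smul, norm_inv, Real.norm_of_nonneg hr.le, inv_mul_le_iff₀ hr]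
        linarith)
      refine ⟨_, Finset.mem_image_of_mem _ (Finset.mk_mem_product hq he), ?_⟩
      have e' : y - (z₀ + q + r • e) = r • (r⁻¹ • (y - (z₀ + q)) - e) := by
        rw [smul_sub, smul_smul, mul_inv_cancel₀ hr.ne', one_smul]; abel
      rw [dist_eq_norm, e', norm_smul, Real.norm_of_nonneg hr.le, mul_comm]
      exact mul_le_mul_of_nonneg_right (hye.trans (min_le_left _ _)) hr.le

/-- At every small scale `r`, the polyhedron has an `ε r`-net consisting of `O(r ^ (-k))` points,
`k = 0, 1, 2, 3`, around each of which a ball of radius `r` has the stated volume in `P`. -/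
theorem IsPolyhedron.exists_nets {P : Set (EuclideanSpace ℝ (Fin 3))} (hP : IsPolyhedron P)
    {κ : ℝ} (hκ : κ ≤ Real.pi) (hκα : ∀ α, IsDihedralAngle P α → κ ≤ α) :
    ∃ c : ℝ, 0 < c ∧ ∀ ε : ℝ, 0 < ε → ∃ C : ℝ, 0 < C ∧ ∃ r₀ : ℝ, 0 < r₀ ∧
      ∀ r : ℝ, 0 < r → r < r₀ → ∃ t : Fin 4 → Finset (EuclideanSpace ℝ (Fin 3)),
        (∀ k, ((t k).card : ℝ) ≤ C * (1 / r) ^ (k : ℕ)) ∧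
        (∀ y ∈ P, ∃ k, ∃ q ∈ t k, dist y q ≤ ε * r) ∧
        ∀ k, ∀ q ∈ t k, (![c, 2 * κ / 3, 2 * Real.pi / 3, 4 * Real.pi / 3] k) * r ^ 3 ≤
          volume.real (P ∩ Metric.ball q r) := by
  classical
  obtain ⟨H, hA, c, hc, hvol⟩ := hP.exists_isArranged
  obtain ⟨V, hV, hVP⟩ := hP.boundary
  have hW : ∀ x ∈ frontier P \ V, ∃ α, 0 < α ∧ κ ≤ α ∧ IsWedgeNear P x α := by
    intro x hx
    obtain ⟨α, hα, hw⟩ := hVP x hx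
    refine ⟨α, hα.1, ?_, hw⟩
    by_cases h : α = Real.pi
    · rw [h]; exact hκ
    · exact hκα α ⟨hα, h, x, hw⟩
  obtain ⟨B, hB, hstrat⟩ := exists_isolated_planeInter H
  obtain ⟨R, hR⟩ := hP.isCompact.isBounded.exists_norm_le
  refine ⟨c, hc, fun ε hε => ?_⟩
  choose C hC hcov using fun I : Finset (EuclideanSpace ℝ (Fin 3) × ℝ) =>
    exists_finset_cover_planeInter I (R + 1) B (half_pos hε)
  refine ⟨∑ I ∈ H.powerset, C I, ?_, min c (min 1 (1 / B)),
    lt_min hc (lt_min one_pos (by positivity)), fun r hr hr0 => ?_⟩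
  · exact Finset.sum_pos (fun I _ => hC I) ⟨∅, Finset.empty_mem_powerset _⟩
  have hrc : r < c := hr0.trans_le (min_le_left _ _)
  have hr1 : r ≤ 1 := (hr0.trans_le ((min_le_right _ _).trans (min_le_left _ _))).le
  have hBr : B * r ≤ 1 := by
    have := (hr0.trans_le ((min_le_right _ _).trans (min_le_right _ _))).le
    rwa [le_div_iff₀ hB, mul_comm] at this
  -- `T I` is the part of `P` that `exists_isolated_planeInter` assigns to the flat `I` at scale
  -- `r`. The sets may overlap; they cover `P`, and `volume_ge_of_finrank` applies at each of their
  -- points.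
  let T : Finset (EuclideanSpace ℝ (Fin 3) × ℝ) → Set (EuclideanSpace ℝ (Fin 3)) := fun I =>
    {y | y ∈ P ∧ ∃ z ∈ planeInter I, ∃ b : ℝ, 0 ≤ b ∧ b ≤ B ∧ ‖y - z‖ ≤ b * r ∧
      ∀ h ∈ H, h ∉ I → (b + 4) * r ≤ |inner ℝ h.1 z - h.2|}
  have hnet : ∀ I, ∃ t : Finset (EuclideanSpace ℝ (Fin 3)),
      (t.card : ℝ) ≤ C I * (1 / r) ^ Module.finrank ℝ (planeDirection I) ∧
      (∀ q ∈ t, q ∈ T I) ∧ ∀ y ∈ T I, ∃ q ∈ t, dist y q ≤ ε * r := by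
    intro I
    obtain ⟨s, hs, hs'⟩ := hcov I r hr hr1
    obtain ⟨t, ht, htT, hty⟩ := exists_finset_subset_cover (T := T I) (c := s)
      (δ := ε / 2 * r) (by
        rintro y ⟨hy, z, hz, b, hb0, hbB, hyz, -⟩
        have hyz' : ‖y - z‖ ≤ B * r :=
          hyz.trans (mul_le_mul_of_nonneg_right hbB hr.le)
        refine hs' z hz ?_ y hyz'
        have h1 := norm_sub_norm_le z y
        rw [norm_sub_rev] at h1
        linarith [hR y hy])
    refine ⟨t, le_trans (by exact_mod_cast ht) hs, htT, fun y hy => ?_⟩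
    obtain ⟨q, hq, hyq⟩ := hty y hy
    exact ⟨q, hq, by linarith⟩
  choose t htc htT hty using hnet
  refine ⟨fun k => (H.powerset.filter fun I => Module.finrank ℝ (planeDirection I) = k).biUnion t,
    fun k => ?_, fun y hy => ?_, fun k q hq => ?_⟩
  · calc _ ≤ ∑ I ∈ H.powerset.filter fun I => Module.finrank ℝ (planeDirection I) = k,
          ((t I).card : ℝ) := by exact_mod_cast Finset.card_biUnion_le
      _ ≤ ∑ I ∈ H.powerset.filter fun I => Module.finrank ℝ (planeDirection I) = k,
          C I * (1 / r) ^ (k : ℕ) := by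
            refine Finset.sum_le_sum fun I hI => ?_
            rw [← (Finset.mem_filter.1 hI).2]
            exact htc I
      _ ≤ ∑ I ∈ H.powerset, C I * (1 / r) ^ (k : ℕ) :=
            Finset.sum_le_sum_of_subset_of_nonneg (Finset.filter_subset _ _) fun I _ _ => by
              have := hC I; positivity
      _ = _ := by rw [Finset.sum_mul]
  · obtain ⟨I, hI, z, hz, b, hb0, hbB, hyz, hfar⟩ := hstrat r hr hBr y
    obtain ⟨q, hq, hyq⟩ := hty I y ⟨hy, z, hz, b, hb0, hbB, hyz, hfar⟩
    have hfin : Module.finrank ℝ (planeDirection I) < 4 := by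
      have := Submodule.finrank_le (planeDirection I)
      rw [finrank_euclideanSpace_fin] at this
      omega
    exact ⟨⟨_, hfin⟩, q, Finset.mem_biUnion.2 ⟨I, Finset.mem_filter.2
      ⟨Finset.mem_powerset.2 hI, rfl⟩, hq⟩, hyq⟩
  · obtain ⟨I, hI, hqI⟩ := Finset.mem_biUnion.1 hq
    obtain ⟨hI1, hI2⟩ := Finset.mem_filter.1 hI
    obtain ⟨hqP, z, hz, b, hb0, hbB, hqz, hfar⟩ := htT I q hqI
    obtain ⟨v1, v2, v3⟩ := volume_ge_of_finrank hA hV hκ hW (Finset.mem_powerset.1 hI1) hz hr hqz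
      hfar hqP
    fin_cases k
    · exact hvol q hqP r hr hrc
    · exact v1 hI2
    · exact v2 hI2
    · exact v3 hI2

/-! ### Elementary properties of the covering radius -/

section CoveringRadius

variable {E : Type*} [MetricSpace E] {P : Set E} {N : ℕ}

theorem bddAbove_range_iInf_dist (hP : Bornology.IsBounded P) (x : Fin N → E) :
    BddAbove (range fun y : P => ⨅ j : Fin N, dist (y : E) (x j)) := by
  rcases isEmpty_or_nonempty (Fin N) with h | ⟨⟨j⟩⟩
  · refine ⟨0, ?_⟩
    rintro _ ⟨y, rfl⟩
    simp [Real.iInf_of_isEmpty]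
  · obtain ⟨D, hD⟩ := hP.subset_closedBall (x j)
    refine ⟨D, ?_⟩
    rintro _ ⟨y, rfl⟩
    exact (ciInf_le ⟨0, by rintro _ ⟨i, rfl⟩; exact dist_nonneg⟩ j).trans (hD y.2)

theorem coveringRadius_nonneg (x : Fin N → E) : 0 ≤ coveringRadius P x :=
  Real.iSup_nonneg fun _ => Real.iInf_nonneg fun _ => dist_nonneg

theorem coveringRadius_le (hP : Bornology.IsBounded P) {x : Fin N → E} (hx : ∀ j, x j ∈ P) :
    coveringRadius P x ≤ Metric.diam P := by
  refine Real.iSup_le (fun y => ?_) Metric.diam_nonneg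
  rcases isEmpty_or_nonempty (Fin N) with h | ⟨⟨j⟩⟩
  · rw [Real.iInf_of_isEmpty]; exact Metric.diam_nonneg
  · exact (ciInf_le ⟨0, by rintro _ ⟨i, rfl⟩; exact dist_nonneg⟩ j).trans
      (Metric.dist_le_diam_of_mem hP y.2 (hx j))

theorem le_coveringRadius (hP : Bornology.IsBounded P) (hN : N ≠ 0) {x : Fin N → E} {q : E}
    (hq : q ∈ P) {r : ℝ} (h : ∀ j, x j ∉ Metric.ball q r) : r ≤ coveringRadius P x := by
  have : Nonempty (Fin N) := ⟨⟨0, Nat.pos_of_ne_zero hN⟩⟩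
  refine le_trans (le_ciInf fun j => ?_) (le_ciSup (bddAbove_range_iInf_dist hP x) ⟨q, hq⟩)
  have := h j
  rw [Metric.mem_ball, not_lt, dist_comm] at this
  exact this

theorem exists_forall_lt_dist_of_lt_coveringRadius {x : Fin N → E} {c : ℝ} (hc : 0 ≤ c)
    (h : c < coveringRadius P x) : ∃ y ∈ P, ∀ j, c < dist y (x j) := by
  rcases isEmpty_or_nonempty P with hE | hE
  · rw [coveringRadius, Real.iSup_of_isEmpty] at h
    linarith
  · obtain ⟨y, hy⟩ := exists_lt_of_lt_ciSup h
    refine ⟨y, y.2, fun j => hy.trans_le (ciInf_le ?_ j)⟩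
    exact ⟨0, by rintro _ ⟨i, rfl⟩; exact dist_nonneg⟩

/-- The covering radius is 1-Lipschitz in the configuration for the sup distance; its measurability
is derived from this. -/
theorem continuous_coveringRadius (hP : Bornology.IsBounded P) :
    Continuous (fun x : Fin N → E => coveringRadius P x) := by
  rcases isEmpty_or_nonempty (Fin N) with h | h
  · exact continuous_of_const fun x y => by rw [Subsingleton.elim x y]
  · refine (LipschitzWith.of_le_add fun x x' => ?_).continuous
    rcases isEmpty_or_nonempty P with hE | hE
    · rw [coveringRadius, coveringRadius, Real.iSup_of_isEmpty, Real.iSup_of_isEmpty, zero_add]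
      exact dist_nonneg
    · refine ciSup_le fun y => ?_
      have h1 : (⨅ j, dist (y : E) (x j)) ≤ (⨅ j, dist (y : E) (x' j)) + dist x x' := by
        rw [← sub_le_iff_le_add]
        refine le_ciInf fun j => ?_
        have h2 : (⨅ j, dist (y : E) (x j)) ≤ dist (y : E) (x j) :=
          ciInf_le ⟨0, by rintro _ ⟨i, rfl⟩; exact dist_nonneg⟩ j
        have h3 := dist_triangle (y : E) (x' j) (x j)
        have h4 := dist_le_pi_dist x x' j
        rw [dist_comm (x' j)] at h3
        linarith
      exact h1.trans (add_le_add_left (le_ciSup (bddAbove_range_iInf_dist hP x') y) _)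

end CoveringRadius

/-! ### Union bound and second moment bound -/

section Moments

theorem measureReal_pi_forall_mem {E : Type*} [MeasurableSpace E] (ν : Measure E)
    [IsProbabilityMeasure ν] (N : ℕ) (B : Set E) :
    (Measure.pi fun _ : Fin N => ν).real {x | ∀ j, x j ∈ B} = ν.real B ^ N := by
  have : {x : Fin N → E | ∀ j, x j ∈ B} = Set.pi univ fun _ => B := by
    ext x; simp
  rw [this, measureReal_def, Measure.pi_pi, Finset.prod_const, Finset.card_univ,
    Fintype.card_fin, ENNReal.toReal_pow]
  rfl

/-- The second moment bound for negatively correlated events. -/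
theorem measureReal_none_mul_sum_le {Ω ι : Type*} [MeasurableSpace Ω] (μ : Measure Ω)
    [IsProbabilityMeasure μ] (t : Finset ι) {A : ι → Set Ω} (hA : ∀ i, MeasurableSet (A i))
    (hneg : ∀ i ∈ t, ∀ j ∈ t, i ≠ j → μ.real (A i ∩ A j) ≤ μ.real (A i) * μ.real (A j)) :
    μ.real {ω | ∀ i ∈ t, ω ∉ A i} * ∑ i ∈ t, μ.real (A i) ≤ 1 := by
  classical
  set m := ∑ i ∈ t, μ.real (A i) with hm
  have hm0 : 0 ≤ m := Finset.sum_nonneg fun _ _ => measureReal_nonneg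
  set B := {ω | ∀ i ∈ t, ω ∉ A i} with hB
  have hBm : MeasurableSet B := by
    have : B = ⋂ i ∈ t, (A i)ᶜ := by ext ω; simp [hB]
    rw [this]
    exact Finset.measurableSet_biInter t fun i _ => (hA i).compl
  let S : Ω → ℝ := fun ω => ∑ i ∈ t, (A i).indicator 1 ω
  have hind : ∀ C : Set Ω, MeasurableSet C → Integrable (C.indicator (1 : Ω → ℝ)) μ :=
    fun C hC => (integrable_const (1 : ℝ)).indicator hC
  have hSint : Integrable S μ := integrable_finsetSum t fun i _ => hind _ (hA i)
  have hS : ∫ ω, S ω ∂μ = m := by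
    rw [integral_finsetSum t fun i _ => hind _ (hA i)]
    exact Finset.sum_congr rfl fun i _ => integral_indicator_one (hA i)
  have hSS : ∀ ω, S ω * S ω = ∑ i ∈ t, ∑ j ∈ t, (A i ∩ A j).indicator 1 ω := by
    intro ω
    rw [Finset.sum_mul_sum]
    refine Finset.sum_congr rfl fun i _ => Finset.sum_congr rfl fun j _ => ?_
    rw [Set.inter_indicator_one]; rfl
  have hSSint : Integrable (fun ω => S ω * S ω) μ := by
    simp_rw [hSS]
    exact integrable_finsetSum t fun i _ => integrable_finsetSum t fun j _ =>
      hind _ ((hA i).inter (hA j))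
  -- The diagonal contributes `m`, the off-diagonal terms at most `m²` by negative correlation. So
  -- the variance of the count `S` is at most `m`, while `(S - m)² = m²` on `B`.
  have hSSval : ∫ ω, S ω * S ω ∂μ ≤ m + m * m := by
    simp_rw [hSS]
    rw [integral_finsetSum t fun i _ => integrable_finsetSum t fun j _ =>
      hind _ ((hA i).inter (hA j))]
    have h1 : ∀ i ∈ t, ∫ ω, ∑ j ∈ t, (A i ∩ A j).indicator (1 : Ω → ℝ) ω ∂μ ≤
        μ.real (A i) + μ.real (A i) * m := by
      intro i hi
      rw [integral_finsetSum t fun j _ => hind _ ((hA i).inter (hA j))]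
      simp_rw [fun j => integral_indicator_one (μ := μ) ((hA i).inter (hA j))]
      rw [← Finset.add_sum_erase t _ hi, inter_self, hm, Finset.mul_sum]
      refine add_le_add_right ?_ _
      refine (Finset.sum_le_sum fun j hj => hneg i hi j (Finset.mem_of_mem_erase hj)
        (Finset.ne_of_mem_erase hj).symm).trans ?_
      exact Finset.sum_le_sum_of_subset_of_nonneg (Finset.erase_subset _ _) fun j _ _ =>
        mul_nonneg measureReal_nonneg measureReal_nonneg
    refine (Finset.sum_le_sum h1).trans ?_
    rw [Finset.sum_add_distrib, ← Finset.sum_mul]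
  have hexp : ∀ ω, (S ω - m) ^ 2 = S ω * S ω - 2 * m * S ω + m ^ 2 := fun ω => by ring
  have hint1 : Integrable (fun ω => S ω * S ω - 2 * m * S ω) μ := hSSint.sub (hSint.const_mul _)
  have hint : Integrable (fun ω => (S ω - m) ^ 2) μ := by
    simp_rw [hexp]
    exact hint1.add (integrable_const _)
  have hvar : ∫ ω, (S ω - m) ^ 2 ∂μ ≤ m := by
    simp_rw [hexp]
    rw [integral_add hint1 (integrable_const _), integral_sub hSSint (hSint.const_mul _),
      integral_const_mul, hS, integral_const, probReal_univ, one_smul]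
    nlinarith
  have hlow : m ^ 2 * μ.real B ≤ ∫ ω, (S ω - m) ^ 2 ∂μ := by
    have h1 : ∫ ω, B.indicator (fun _ => m ^ 2) ω ∂μ = m ^ 2 * μ.real B := by
      rw [integral_indicator_const _ hBm, smul_eq_mul, mul_comm]
    rw [← h1]
    refine integral_mono ((integrable_const _).indicator hBm) hint fun ω => ?_
    by_cases hω : ω ∈ B
    · have hS0 : S ω = 0 := Finset.sum_eq_zero fun i hi => indicator_of_notMem (hω i hi) _
      simp only [indicator_of_mem hω, hS0]
      exact le_of_eq (by ring)
    · simp only [indicator_of_notMem hω]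
      positivity
  rcases hm0.eq_or_lt with h0 | h0
  · rw [← h0, mul_zero]; exact zero_le_one
  · have := hlow.trans hvar
    nlinarith

variable {E : Type*} [MetricSpace E] [MeasurableSpace E] [BorelSpace E] {P : Set E}

theorem measurableSet_forall_notMem_ball (N : ℕ) (q : E) (r : ℝ) :
    MeasurableSet {x : Fin N → E | ∀ j, x j ∉ Metric.ball q r} := by
  have : {x : Fin N → E | ∀ j, x j ∉ Metric.ball q r} =
      Set.pi univ fun _ => (Metric.ball q r)ᶜ := by
    ext x; simp
  rw [this]
  exact MeasurableSet.univ_pi fun _ => measurableSet_ball.compl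

theorem measureReal_pi_forall_notMem_ball (ν : Measure E) [IsProbabilityMeasure ν] (N : ℕ)
    (q : E) (r : ℝ) :
    (Measure.pi fun _ : Fin N => ν).real {x | ∀ j, x j ∉ Metric.ball q r} =
      (1 - ν.real (Metric.ball q r)) ^ N := by
  rw [← probReal_compl_eq_one_sub measurableSet_ball]
  exact measureReal_pi_forall_mem ν N (Metric.ball q r)ᶜ

/-- If balls of radius `r` around an `ε r`-net have given measures, the covering radius
rarely exceeds `(1 + ε) r`. -/
theorem measureReal_coveringRadius_gt_le (ν : Measure E) [IsProbabilityMeasure ν] {ι : Type*}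
    [Fintype ι] {t : ι → Finset E} {ε r : ℝ} (hε : 0 ≤ ε) (hr : 0 ≤ r) {w : ι → ℝ}
    (hcov : ∀ y ∈ P, ∃ k, ∃ q ∈ t k, dist y q ≤ ε * r)
    (hw : ∀ k, ∀ q ∈ t k, w k ≤ ν.real (Metric.ball q r)) (N : ℕ) :
    (Measure.pi fun _ : Fin N => ν).real {x | (1 + ε) * r < coveringRadius P x} ≤
      ∑ k, (t k).card * Real.exp (-(N * w k)) := by
  classical
  -- A point `y` farther than `(1 + ε) r` from the sample has a net point within `ε r`, whose
  -- `r`-ball then misses the sample.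
  have hsub : {x : Fin N → E | (1 + ε) * r < coveringRadius P x} ⊆
      ⋃ k ∈ (Finset.univ : Finset ι), ⋃ q ∈ t k, {x | ∀ j, x j ∉ Metric.ball q r} := by
    intro x hx
    obtain ⟨y, hy, hyx⟩ := exists_forall_lt_dist_of_lt_coveringRadius (by positivity) hx
    obtain ⟨k, q, hq, hyq⟩ := hcov y hy
    simp only [mem_iUnion]
    refine ⟨k, Finset.mem_univ k, q, hq, fun j hj => ?_⟩
    have h1 := dist_triangle y q (x j)
    have h2 := Metric.mem_ball'.1 hj
    have h3 := hyx j
    linarith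
  calc _ ≤ (Measure.pi fun _ : Fin N => ν).real (⋃ k ∈ (Finset.univ : Finset ι),
          ⋃ q ∈ t k, {x | ∀ j, x j ∉ Metric.ball q r}) := measureReal_mono hsub (measure_ne_top _ _)
    _ ≤ ∑ k, (Measure.pi fun _ : Fin N => ν).real
          (⋃ q ∈ t k, {x | ∀ j, x j ∉ Metric.ball q r}) := measureReal_biUnion_finset_le _ _
    _ ≤ _ := by
      refine Finset.sum_le_sum fun k _ => ?_
      refine (measureReal_biUnion_finset_le _ _).trans ?_
      rw [← nsmul_eq_mul]
      refine Finset.sum_le_card_nsmul _ _ _ fun q hq => ?_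
      rw [measureReal_pi_forall_notMem_ball]
      have h1 : 1 - ν.real (Metric.ball q r) ≤ Real.exp (-w k) := by
        have := Real.add_one_le_exp (-w k)
        have := hw k q hq
        linarith
      have h2 : 0 ≤ 1 - ν.real (Metric.ball q r) := by
        have := measureReal_le_one (μ := ν) (s := Metric.ball q r)
        linarith
      refine (pow_le_pow_left₀ h2 h1 N).trans ?_
      rw [← Real.exp_nat_mul, mul_neg]

/-- If `P` contains the centres of many disjoint balls of small measure, the covering radius is
rarely smaller than their radius. -/
theorem measureReal_coveringRadius_lt_mul_le (hP : Bornology.IsBounded P) (ν : Measure E)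
    [IsProbabilityMeasure ν] {t : Finset E} {r w : ℝ} (htP : ∀ q ∈ t, q ∈ P)
    (hdisj : ∀ q ∈ t, ∀ q' ∈ t, q ≠ q' → Disjoint (Metric.ball q r) (Metric.ball q' r))
    (hw1 : w ≤ 1) (hw : ∀ q ∈ t, ν.real (Metric.ball q r) ≤ w) {N : ℕ} (hN : N ≠ 0) :
    (Measure.pi fun _ : Fin N => ν).real {x | coveringRadius P x < r} *
      (t.card * (1 - w) ^ N) ≤ 1 := by
  classical
  set π := Measure.pi fun _ : Fin N => ν with hπ
  let A : E → Set (Fin N → E) := fun q => {x | ∀ j, x j ∉ Metric.ball q r}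
  have hmain := measureReal_none_mul_sum_le π t (A := A)
    (fun q => measurableSet_forall_notMem_ball N q r) (by
      intro q hq q' hq' hne
      -- For disjoint balls of measures `a` and `b`, negative correlation is `(1 - a - b)^N ≤ ((1 -
      -- a)(1 - b))^N`.
      have h1 : A q ∩ A q' = {x | ∀ j, x j ∈ (Metric.ball q r ∪ Metric.ball q' r)ᶜ} := by
        ext x
        simp only [A, mem_inter_iff, mem_ofPred_eq, mem_compl_iff, mem_union, not_or, forall_and]
      have h2 : ν.real (Metric.ball q r ∪ Metric.ball q' r)ᶜ =
          1 - (ν.real (Metric.ball q r) + ν.real (Metric.ball q' r)) := by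
        rw [probReal_compl_eq_one_sub (measurableSet_ball.union measurableSet_ball),
          measureReal_union (hdisj q hq q' hq' hne) measurableSet_ball]
      rw [h1, measureReal_pi_forall_mem, measureReal_pi_forall_notMem_ball,
        measureReal_pi_forall_notMem_ball, ← mul_pow]
      refine pow_le_pow_left₀ measureReal_nonneg ?_ N
      rw [h2]
      have h3 := mul_nonneg (measureReal_nonneg (μ := ν) (s := Metric.ball q r))
        (measureReal_nonneg (μ := ν) (s := Metric.ball q' r))
      linarith)
  refine le_trans (mul_le_mul ?_ ?_ ?_ measureReal_nonneg) hmain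
  · refine measureReal_mono fun x hx q hq hxq => ?_
    exact absurd (le_coveringRadius hP hN (htP q hq) hxq) (not_le.2 hx)
  · rw [← nsmul_eq_mul]
    refine Finset.card_nsmul_le_sum _ _ _ fun q hq => ?_
    rw [measureReal_pi_forall_notMem_ball]
    exact pow_le_pow_left₀ (by linarith) (by linarith [hw q hq]) N
  · have : 0 ≤ 1 - w := by linarith
    positivity

end Moments

/-! ### Disjoint balls along edges and faces -/

theorem exists_finset_of_separated {E ι : Type*} [MetricSpace E] (s : Finset ι) {f : ι → E}
    {r : ℝ} (hr : 0 < r) (hf : ∀ i ∈ s, ∀ j ∈ s, i ≠ j → 2 * r ≤ dist (f i) (f j)) :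
    ∃ t : Finset E, t.card = s.card ∧ (∀ q ∈ t, ∃ i ∈ s, f i = q) ∧
      ∀ q ∈ t, ∀ q' ∈ t, q ≠ q' → Disjoint (Metric.ball q r) (Metric.ball q' r) := by
  classical
  refine ⟨s.image f, Finset.card_image_of_injOn fun i hi j hj hij => ?_,
    fun q hq => Finset.mem_image.1 hq, ?_⟩
  · by_contra hne
    have h1 := hf i hi j hj hne
    have h2 : f i = f j := hij
    rw [h2, dist_self] at h1
    linarith
  · intro q hq q' hq' hne
    obtain ⟨i, hi, rfl⟩ := Finset.mem_image.1 hq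
    obtain ⟨j, hj, rfl⟩ := Finset.mem_image.1 hq'
    apply Metric.ball_disjoint_ball
    have := hf i hi j hj fun h => hne (by rw [h])
    linarith

theorem two_mul_le_abs_of_ne {i j : ℕ} (hij : i ≠ j) {r : ℝ} (hr : 0 < r) :
    2 * r ≤ |2 * r * i - 2 * r * j| := by
  have h1 : (1 : ℝ) ≤ |(i : ℝ) - j| := by
    have : (1 : ℤ) ≤ |(i : ℤ) - j| := Int.one_le_abs (sub_ne_zero.2 (by exact_mod_cast hij))
    exact_mod_cast this
  rw [← mul_sub, abs_mul, abs_of_pos (by positivity : 0 < 2 * r)]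
  nlinarith

theorem div_le_floor {x : ℝ} (hx : 2 ≤ x) : x / 2 ≤ (⌊x⌋₊ : ℝ) := by
  have := Nat.lt_floor_add_one x
  linarith

/-- Along an edge of angle `α` there are `≍ 1 / r` disjoint balls of radius `r` meeting `P` in
volume `2α/3 r ^ 3`. -/
theorem IsWedgeNear.exists_separated_edge {P : Set (EuclideanSpace ℝ (Fin 3))}
    {x : EuclideanSpace ℝ (Fin 3)} {α : ℝ} (hx : IsWedgeNear P x α) (h0 : 0 < α)
    (hπ : α ≤ Real.pi) :
    ∃ c : ℝ, 0 < c ∧ ∃ r₀ : ℝ, 0 < r₀ ∧ ∀ r : ℝ, 0 < r → r < r₀ →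
      ∃ t : Finset (EuclideanSpace ℝ (Fin 3)), c * (1 / r) ^ 1 ≤ t.card ∧ (∀ q ∈ t, q ∈ P) ∧
        (∀ q ∈ t, ∀ q' ∈ t, q ≠ q' → Disjoint (Metric.ball q r) (Metric.ball q' r)) ∧
        ∀ q ∈ t, volume.real (P ∩ Metric.ball q r) ≤ 2 * α / 3 * r ^ 3 := by
  obtain ⟨u, v, hu, hv, huv, R, hR, hPW⟩ := hx
  obtain ⟨b, rfl, rfl⟩ := exists_orthonormalBasis_of_pair hu hv huv
  refine ⟨R / 8, by positivity, R / 8, by positivity, fun r hr hrR => ?_⟩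
  -- The centres stay within `R / 2` of `x`, so their `r`-balls stay in the ball where `P` is the
  -- wedge.
  set n := ⌊R / (4 * r)⌋₊ with hn
  have hn1 : R / (4 * r) / 2 ≤ n := div_le_floor (by rw [le_div_iff₀ (by positivity)]; linarith)
  have hn2 : (n : ℝ) ≤ R / (4 * r) := Nat.floor_le (by positivity)
  rw [le_div_iff₀ (by positivity)] at hn2
  let f : ℕ → EuclideanSpace ℝ (Fin 3) := fun i => x + (2 * r * i) • b 0
  obtain ⟨t, htc, htf, htd⟩ := exists_finset_of_separated (Finset.range n) (f := f) hr (by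
    intro i _ j _ hij
    rw [dist_eq_norm, add_sub_add_left_eq_sub, ← sub_smul, norm_smul, b.orthonormal.1 0, mul_one]
    exact two_mul_le_abs_of_ne hij hr)
  have hb : ∀ i j, i ≠ j → inner ℝ (b i) (b j) = 0 := fun i j hij => b.orthonormal.2 hij
  have key : ∀ i ∈ Finset.range n, f i ∈ P ∧
      volume.real (P ∩ Metric.ball (f i) r) ≤ 2 * α / 3 * r ^ 3 := by
    intro i hi
    have hi' : (i : ℝ) ≤ n := by exact_mod_cast (Finset.mem_range.1 hi).le
    have hdist : dist (f i) x ≤ R / 2 := by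
      rw [dist_eq_norm, add_sub_cancel_left, norm_smul, b.orthonormal.1 0, mul_one,
        Real.norm_of_nonneg (by positivity)]
      nlinarith
    have hsub : Metric.ball (f i) r ⊆ Metric.ball x R :=
      Metric.ball_subset_ball' (by linarith)
    -- The wedge is invariant under translation along its edge.
    have hW : dihedralWedge x (b 1) (b 2) α = dihedralWedge (f i) (b 1) (b 2) α := by
      ext y
      have e : y - x = (y - f i) + (2 * r * i) • b 0 := by simp only [f]; abel
      simp only [dihedralWedge, mem_ofPred_eq, e, inner_add_right, inner_smul_right,
        hb 1 0 (by decide), hb 2 0 (by decide), mul_zero, add_zero]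
    have hfW : f i ∈ dihedralWedge x (b 1) (b 2) α := by
      rw [hW, mem_dihedralWedge_iff h0 hπ]
      simp
    constructor
    · have : f i ∈ P ∩ Metric.ball x R := by
        rw [hPW]
        exact ⟨hfW, hsub (Metric.mem_ball_self hr)⟩
      exact this.1
    · rw [← volume_dihedralWedge_inter_ball h0 hπ hu hv huv (f i) hr.le]
      apply measureReal_inter_ball_mono
      rintro y ⟨hyP, hy⟩
      have : y ∈ P ∩ Metric.ball x R := ⟨hyP, hsub hy⟩
      rw [hPW, hW] at this
      exact this.1
  refine ⟨t, ?_, fun q hq => ?_, htd, fun q hq => ?_⟩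
  · rw [htc, Finset.card_range, pow_one]
    refine le_trans (le_of_eq ?_) hn1
    field_simp
    norm_num
  · obtain ⟨i, hi, rfl⟩ := htf q hq
    exact (key i hi).1
  · obtain ⟨i, hi, rfl⟩ := htf q hq
    exact (key i hi).2

/-- Away from the edge, close to the half-plane `t = 0`, a wedge is contained in a half-space. -/
theorem sin_nonneg_of_mem_wedge {α s t σ a b : ℝ} (hα : α < 2 * Real.pi) (hs : 0 ≤ s)
    (ht0 : 0 ≤ t) (htα : t ≤ α) (ha : a = s * Real.cos t) (hb : b = s * Real.sin t)
    (hσ : Real.sin α < 0 → σ ≤ -Real.sin α) (ha0 : 0 < a) (hba : -(a * σ) < b) : 0 ≤ b := by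
  -- From `a > 0 > b` the angle satisfies `3π/2 < t ≤ α < 2π`, so `sin t ≤ sin α < 0`. With `a ≤ s`
  -- this gives `b ≤ s sin α ≤ a sin α ≤ -a σ`, contradicting `hba`.
  by_contra! hneg
  have hs0 : 0 < s := by
    rcases hs.eq_or_lt with h | h
    · rw [← h, zero_mul] at ha; linarith
    · exact h
  have hsin : Real.sin t < 0 := by
    by_contra! h
    have := mul_nonneg hs0.le h
    linarith
  have hcos : 0 < Real.cos t := by
    by_contra! h
    have := mul_nonpos_of_nonneg_of_nonpos hs0.le h
    linarith
  have htπ : Real.pi < t := by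
    by_contra! h
    linarith [Real.sin_nonneg_of_nonneg_of_le_pi ht0 h]
  have ht3 : Real.pi + Real.pi / 2 < t := by
    by_contra! h
    linarith [Real.cos_nonpos_of_pi_div_two_le_of_le (x := t) (by linarith [Real.pi_pos])
      (by linarith)]
  have hmono : Real.sin t ≤ Real.sin α := by
    rw [← Real.sin_sub_two_pi t, ← Real.sin_sub_two_pi α]
    exact Real.sin_le_sin_of_le_of_le_pi_div_two (by linarith) (by linarith [Real.pi_pos])
      (by linarith)
  have hsα : Real.sin α < 0 := by
    rw [← Real.sin_sub_two_pi α]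
    exact Real.sin_neg_of_neg_of_neg_pi_lt (by linarith) (by linarith [Real.pi_pos])
  have hσ' := hσ hsα
  have has : a ≤ s := by rw [ha]; nlinarith [Real.cos_le_one t]
  have h1 : s * Real.sin t ≤ s * Real.sin α := mul_le_mul_of_nonneg_left hmono hs0.le
  nlinarith

/-- On the faces meeting in an edge there are `≍ 1 / r ^ 2` disjoint balls of radius `r` meeting
`P` in at most half of their volume. -/
theorem IsWedgeNear.exists_separated_face {P : Set (EuclideanSpace ℝ (Fin 3))}
    {x : EuclideanSpace ℝ (Fin 3)} {α : ℝ} (hx : IsWedgeNear P x α) (h0 : 0 < α)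
    (hα : α < 2 * Real.pi) :
    ∃ c : ℝ, 0 < c ∧ ∃ r₀ : ℝ, 0 < r₀ ∧ ∀ r : ℝ, 0 < r → r < r₀ →
      ∃ t : Finset (EuclideanSpace ℝ (Fin 3)), c * (1 / r) ^ 2 ≤ t.card ∧ (∀ q ∈ t, q ∈ P) ∧
        (∀ q ∈ t, ∀ q' ∈ t, q ≠ q' → Disjoint (Metric.ball q r) (Metric.ball q' r)) ∧
        ∀ q ∈ t, volume.real (P ∩ Metric.ball q r) ≤ 2 * Real.pi / 3 * r ^ 3 := by
  obtain ⟨u, v, hu, hv, huv, R, hR, hPW⟩ := hx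
  obtain ⟨b, rfl, rfl⟩ := exists_orthonormalBasis_of_pair hu hv huv
  obtain ⟨σ, hσ0, hσ⟩ : ∃ σ : ℝ, 0 < σ ∧ (Real.sin α < 0 → σ ≤ -Real.sin α) := by
    by_cases h : Real.sin α < 0
    · exact ⟨-Real.sin α, by linarith, fun _ => le_rfl⟩
    · exact ⟨1, one_pos, fun h' => absurd h' h⟩
  refine ⟨(R / 32) ^ 2, by positivity, min (R / 32) (R / 8 * σ), by positivity,
    fun r hr hr0 => ?_⟩
  have hrR : r < R / 32 := hr0.trans_le (min_le_left _ _)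
  have hrσ : r < R / 8 * σ := hr0.trans_le (min_le_right _ _)
  set n := ⌊R / (16 * r)⌋₊ with hn
  have hn1 : R / (16 * r) / 2 ≤ n := div_le_floor (by rw [le_div_iff₀ (by positivity)]; linarith)
  have hn2 : (n : ℝ) ≤ R / (16 * r) := Nat.floor_le (by positivity)
  rw [le_div_iff₀ (by positivity)] at hn2
  have hb : ∀ i j, i ≠ j → inner ℝ (b i) (b j) = 0 := fun i j hij => b.orthonormal.2 hij
  have hb1 : ∀ i, inner ℝ (b i) (b i) = 1 := fun i => by
    rw [real_inner_self_eq_norm_sq, b.orthonormal.1 i, one_pow]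
  -- A square grid of step `2 r` in the face `t = 0`, starting at distance `R / 4` from the edge.
  -- Points of the balls keep first coordinate above `R / 8`, and `r < (R / 8) σ` keeps them away
  -- from the other face when the angle is reflex.
  let f : ℕ × ℕ → EuclideanSpace ℝ (Fin 3) := fun i =>
    x + ((R / 4 + 2 * r * i.1) • b 1 + (2 * r * i.2) • b 0)
  obtain ⟨t, htc, htf, htd⟩ := exists_finset_of_separated (Finset.range n ×ˢ Finset.range n)
    (f := f) hr (by
    intro i _ j _ hij
    have e : f i - f j = (2 * r * i.1 - 2 * r * j.1) • b 1 + (2 * r * i.2 - 2 * r * j.2) • b 0 := by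
      simp only [f]; module
    have h1 : inner ℝ (b 1) (f i - f j) = 2 * r * i.1 - 2 * r * j.1 := by
      rw [e, inner_add_right, inner_smul_right, inner_smul_right, hb1, hb 1 0 (by decide)]; ring
    have h2 : inner ℝ (b 0) (f i - f j) = 2 * r * i.2 - 2 * r * j.2 := by
      rw [e, inner_add_right, inner_smul_right, inner_smul_right, hb1, hb 0 1 (by decide)]; ring
    have h3 : ∀ k, |inner ℝ (b k) (f i - f j)| ≤ dist (f i) (f j) := fun k => by
      have := abs_real_inner_le_norm (b k) (f i - f j)
      rwa [b.orthonormal.1 k, one_mul, ← dist_eq_norm] at this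
    by_cases hi : i.1 = j.1
    · have hi2 : i.2 ≠ j.2 := fun h => hij (Prod.ext hi h)
      refine le_trans ?_ (h3 0)
      rw [h2]
      exact two_mul_le_abs_of_ne hi2 hr
    · refine le_trans ?_ (h3 1)
      rw [h1]
      exact two_mul_le_abs_of_ne hi hr)
  have key : ∀ i ∈ Finset.range n ×ˢ Finset.range n, f i ∈ P ∧
      volume.real (P ∩ Metric.ball (f i) r) ≤ 2 * Real.pi / 3 * r ^ 3 := by
    intro i hi
    obtain ⟨hi1, hi2⟩ := Finset.mem_product.1 hi
    have hi1' : (i.1 : ℝ) ≤ n := by exact_mod_cast (Finset.mem_range.1 hi1).le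
    have hi2' : (i.2 : ℝ) ≤ n := by exact_mod_cast (Finset.mem_range.1 hi2).le
    have hdist : dist (f i) x ≤ R / 2 := by
      rw [dist_eq_norm, add_sub_cancel_left]
      refine (norm_add_le _ _).trans ?_
      rw [norm_smul, norm_smul, b.orthonormal.1 0, b.orthonormal.1 1, mul_one, mul_one,
        Real.norm_of_nonneg (by positivity), Real.norm_of_nonneg (by positivity)]
      nlinarith
    have hsub : Metric.ball (f i) r ⊆ Metric.ball x R :=
      Metric.ball_subset_ball' (by linarith)
    have hfu : inner ℝ (b 1) (f i - x) = R / 4 + 2 * r * i.1 := by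
      simp only [f, add_sub_cancel_left]
      rw [inner_add_right, inner_smul_right, inner_smul_right, hb1, hb 1 0 (by decide)]; ring
    have hfv : inner ℝ (b 2) (f i - x) = 0 := by
      simp only [f, add_sub_cancel_left]
      rw [inner_add_right, inner_smul_right, inner_smul_right, hb 2 1 (by decide),
        hb 2 0 (by decide)]; ring
    constructor
    · have : f i ∈ P ∩ Metric.ball x R := by
        rw [hPW]
        refine ⟨⟨R / 4 + 2 * r * i.1, by positivity, 0, ⟨le_rfl, h0.le⟩, ?_, ?_⟩,
          hsub (Metric.mem_ball_self hr)⟩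
        · rw [hfu, Real.cos_zero, mul_one]
        · rw [hfv, Real.sin_zero, mul_zero]
      exact this.1
    · rw [← volume_dihedralWedge_inter_ball Real.pi_pos le_rfl hu hv huv (f i) hr.le]
      apply measureReal_inter_ball_mono
      rintro y ⟨hyP, hy⟩
      have hyW : y ∈ P ∩ Metric.ball x R := ⟨hyP, hsub hy⟩
      rw [hPW] at hyW
      obtain ⟨s, hs, τ, ⟨hτ0, hτα⟩, h1, h2⟩ := hyW.1
      have hsplit : ∀ k, inner ℝ (b k) (y - x) =
          inner ℝ (b k) (y - f i) + inner ℝ (b k) (f i - x) := fun k => by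
        rw [← inner_add_right, sub_add_sub_cancel]
      have habs : ∀ k, |inner ℝ (b k) (y - f i)| < r := fun k => by
        have := abs_real_inner_le_norm (b k) (y - f i)
        rw [b.orthonormal.1 k, one_mul, ← dist_eq_norm] at this
        exact this.trans_lt hy
      have ha : R / 8 < inner ℝ (b 1) (y - x) := by
        rw [hsplit, hfu]
        have := (abs_lt.1 (habs 1)).1
        have : 0 ≤ 2 * r * i.1 := by positivity
        linarith
      have hv' : 0 ≤ inner ℝ (b 2) (y - x) := by
        refine sin_nonneg_of_mem_wedge hα hs hτ0 hτα h1 h2 hσ (by linarith) ?_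
        rw [hsplit 2, hfv, add_zero]
        have := (abs_lt.1 (habs 2)).1
        nlinarith
      rw [hsplit, hfv, add_zero] at hv'
      rw [mem_dihedralWedge_iff Real.pi_pos le_rfl]
      simp [hv']
  refine ⟨t, ?_, fun q hq => ?_, htd, fun q hq => ?_⟩
  · rw [htc, Finset.card_product, Finset.card_range, ← mul_pow, ← sq]
    push_cast
    refine pow_le_pow_left₀ (by positivity) (le_trans (le_of_eq ?_) hn1) 2
    field_simp
    norm_num
  · obtain ⟨i, hi, rfl⟩ := htf q hq
    exact (key i hi).1
  · obtain ⟨i, hi, rfl⟩ := htf q hq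
    exact (key i hi).2

/-! ### The logarithmic scale -/

/-- The order of magnitude `(log N / N) ^ (1/3)` of the covering radius. -/
noncomputable def logScale (N : ℕ) : ℝ := (Real.log N / N) ^ (1 / 3 : ℝ)

theorem log_natCast_pos {N : ℕ} (hN : 2 ≤ N) : 0 < Real.log N :=
  Real.log_pos (by exact_mod_cast hN)

theorem logScale_pos {N : ℕ} (hN : 2 ≤ N) : 0 < logScale N := by
  have := log_natCast_pos hN
  have : (0 : ℝ) < N := by exact_mod_cast (by omega : 0 < N)
  unfold logScale
  positivity

theorem logScale_pow_three (N : ℕ) : logScale N ^ 3 = Real.log N / N := by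
  have h : 0 ≤ Real.log N / N := div_nonneg (Real.log_natCast_nonneg N) (Nat.cast_nonneg N)
  rw [logScale, ← Real.rpow_natCast, ← Real.rpow_mul h]
  norm_num

theorem logScale_rpow_mul {N : ℕ} (hN : 2 ≤ N) (p : ℝ) :
    logScale N ^ p * ((N : ℝ) / Real.log N) ^ (p / 3) = 1 := by
  have h1 := log_natCast_pos hN
  have h2 : (0 : ℝ) < N := by exact_mod_cast (by omega : 0 < N)
  rw [logScale, ← Real.rpow_mul (by positivity), show 1 / 3 * p = p / 3 by ring,
    ← Real.mul_rpow (by positivity) (by positivity)]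
  rw [show Real.log N / N * (N / Real.log N) = 1 by field_simp, Real.one_rpow]

theorem div_log_rpow_le {N : ℕ} (hN : 3 ≤ N) {s : ℝ} (hs : 0 ≤ s) :
    ((N : ℝ) / Real.log N) ^ s ≤ (N : ℝ) ^ s := by
  have h2 : (0 : ℝ) < N := by exact_mod_cast (by omega : 0 < N)
  have h1 : 1 ≤ Real.log N := by
    rw [Real.le_log_iff_exp_le h2]
    have := Real.exp_one_lt_three
    have : (3 : ℝ) ≤ N := by exact_mod_cast hN
    linarith
  exact Real.rpow_le_rpow (by positivity) (div_le_self h2.le h1) hs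

theorem one_div_logScale_pow {N : ℕ} (hN : 2 ≤ N) (k : ℕ) :
    (1 / logScale N) ^ k = ((N : ℝ) / Real.log N) ^ ((k : ℝ) / 3) := by
  have h := logScale_rpow_mul hN k
  rw [Real.rpow_natCast] at h
  have hpos := pow_pos (logScale_pos hN) k
  rw [one_div, inv_pow]
  exact (eq_inv_of_mul_eq_one_right h).symm

theorem tendsto_log_div_natCast : Tendsto (fun N : ℕ => Real.log N / N) atTop (𝓝 0) := by
  have := (Real.tendsto_pow_log_div_mul_add_atTop 1 0 1 one_ne_zero).comp
    (tendsto_natCast_atTop_atTop (R := ℝ))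
  simpa [Function.comp_def] using this

theorem tendsto_logScale : Tendsto logScale atTop (𝓝 0) := by
  have := tendsto_log_div_natCast.rpow_const (p := (1 / 3 : ℝ)) (Or.inr (by norm_num))
  rwa [Real.zero_rpow (by norm_num)] at this

theorem tendsto_natCast_rpow_neg {s : ℝ} (hs : s < 0) :
    Tendsto (fun N : ℕ => (N : ℝ) ^ s) atTop (𝓝 0) := by
  have := (tendsto_rpow_neg_atTop (neg_pos.2 hs)).comp
    (tendsto_natCast_atTop_atTop (R := ℝ))
  simpa [Function.comp_def] using this

theorem eventually_mul_logScale_lt (a : ℝ) {r₀ : ℝ} (hr₀ : 0 < r₀) :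
    ∀ᶠ N : ℕ in atTop, a * logScale N < r₀ := by
  have h := tendsto_logScale.const_mul a
  rw [mul_zero] at h
  exact h.eventually (gt_mem_nhds hr₀)

/-! ### Tail probabilities at the logarithmic scale -/

section Tails

variable {E : Type*} [MetricSpace E] [MeasurableSpace E] [BorelSpace E] {P : Set E}
  {ν : Measure E} [IsProbabilityMeasure ν]

/-- The `k`-th net contributes `O(N^(k/3))` centres, each with empty ball with probability at most
`N^(-w k * a³)`. The weight `N^m` serves with `m = 0` for concentration and with `m = p / 3` for the
moments. -/
theorem tendsto_measureReal_coveringRadius_gt {n : ℕ} {w : Fin n → ℝ} {ε a m : ℝ}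
    (hε : 0 < ε) (ha : 0 < a)
    (hnets : ∃ C : ℝ, 0 < C ∧ ∃ r₀ : ℝ, 0 < r₀ ∧
      ∀ r : ℝ, 0 < r → r < r₀ → ∃ t : Fin n → Finset E,
        (∀ k, ((t k).card : ℝ) ≤ C * (1 / r) ^ (k : ℕ)) ∧
        (∀ y ∈ P, ∃ k, ∃ q ∈ t k, dist y q ≤ ε * r) ∧
        ∀ k, ∀ q ∈ t k, w k * r ^ 3 ≤ ν.real (Metric.ball q r))
    (hw : ∀ k : Fin n, (k : ℝ) / 3 + m < w k * a ^ 3) :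
    Tendsto (fun N : ℕ => (Measure.pi fun _ : Fin N => ν).real
      {x | (1 + ε) * (a * logScale N) < coveringRadius P x} * (N : ℝ) ^ m) atTop (𝓝 0) := by
  obtain ⟨C, hC, r₀, hr₀, hnets⟩ := hnets
  have hlim : Tendsto (fun N : ℕ => ∑ k : Fin n,
      C * (1 / a) ^ (k : ℕ) * (N : ℝ) ^ ((k : ℝ) / 3 + m - w k * a ^ 3)) atTop (𝓝 0) := by
    rw [← Finset.sum_const_zero (s := (Finset.univ : Finset (Fin n))) (M := ℝ)]
    refine tendsto_finsetSum _ fun k _ => ?_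
    have := (tendsto_natCast_rpow_neg (s := (k : ℝ) / 3 + m - w k * a ^ 3)
      (by linarith [hw k])).const_mul (C * (1 / a) ^ (k : ℕ))
    rwa [mul_zero] at this
  refine tendsto_of_tendsto_of_tendsto_of_le_of_le' tendsto_const_nhds hlim
    (Eventually.of_forall fun N => by positivity) ?_
  filter_upwards [eventually_ge_atTop 3, eventually_mul_logScale_lt a hr₀] with N hN hNr
  have hN0 : (0 : ℝ) < N := by exact_mod_cast (by omega : 0 < N)
  have hl := logScale_pos (by omega : 2 ≤ N)
  obtain ⟨t, htc, htcov, htw⟩ := hnets (a * logScale N) (by positivity) hNr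
  have h1 := measureReal_coveringRadius_gt_le (P := P) ν hε.le (by positivity)
    htcov htw N
  refine (mul_le_mul_of_nonneg_right h1 (by positivity)).trans ?_
  rw [Finset.sum_mul]
  refine Finset.sum_le_sum fun k _ => ?_
  have h2 : Real.exp (-(N * (w k * (a * logScale N) ^ 3))) = (N : ℝ) ^ (-(w k * a ^ 3)) := by
    rw [Real.rpow_def_of_pos hN0, mul_pow, logScale_pow_three]
    congr 1
    field_simp
  have h3 : (1 / (a * logScale N)) ^ (k : ℕ) ≤ (1 / a) ^ (k : ℕ) * (N : ℝ) ^ ((k : ℝ) / 3) := by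
    have e : 1 / (a * logScale N) = 1 / a * (1 / logScale N) := by field_simp
    rw [e, mul_pow, one_div_logScale_pow (by omega)]
    exact mul_le_mul_of_nonneg_left (div_log_rpow_le hN (by positivity)) (by positivity)
  rw [h2]
  have h4 : ((k : ℝ) / 3 + m - w k * a ^ 3) = (k : ℝ) / 3 + -(w k * a ^ 3) + m := by ring
  rw [h4, Real.rpow_add hN0, Real.rpow_add hN0]
  calc _ ≤ C * ((1 / a) ^ (k : ℕ) * (N : ℝ) ^ ((k : ℝ) / 3)) * (N : ℝ) ^ (-(w k * a ^ 3)) *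
        (N : ℝ) ^ m := by
        have := (htc k).trans (mul_le_mul_of_nonneg_left h3 hC.le)
        gcongr
    _ = _ := by ring

theorem exp_neg_div_le {q : ℝ} (hq1 : q < 1) : Real.exp (-(q / (1 - q))) ≤ 1 - q := by
  have h1 : 0 < 1 - q := by linarith
  have h2 := Real.add_one_le_exp (q / (1 - q))
  have h3 : q / (1 - q) + 1 = (1 - q)⁻¹ := by field_simp; ring
  rw [h3] at h2
  rw [Real.exp_neg]
  exact inv_le_of_inv_le₀ h1 h2

/-- The expected number of missed balls is at least a constant times `(N / log N)^(k/3) N^(-l')`,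
which tends to infinity, and its reciprocal bounds the probability. -/
theorem tendsto_measureReal_coveringRadius_lt (hP : Bornology.IsBounded P) {k : ℕ} {w a : ℝ}
    (hw : 0 < w) (ha : 0 < a)
    (hsep : ∃ c : ℝ, 0 < c ∧ ∃ r₀ : ℝ, 0 < r₀ ∧ ∀ r : ℝ, 0 < r → r < r₀ →
      ∃ t : Finset E, c * (1 / r) ^ k ≤ t.card ∧ (∀ q ∈ t, q ∈ P) ∧
        (∀ q ∈ t, ∀ q' ∈ t, q ≠ q' → Disjoint (Metric.ball q r) (Metric.ball q' r)) ∧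
        ∀ q ∈ t, ν.real (Metric.ball q r) ≤ w * r ^ 3)
    (hwk : w * a ^ 3 < (k : ℝ) / 3) :
    Tendsto (fun N : ℕ => (Measure.pi fun _ : Fin N => ν).real
      {x | coveringRadius P x < a * logScale N}) atTop (𝓝 0) := by
  obtain ⟨c, hc, r₀, hr₀, hsep⟩ := hsep
  set l := w * a ^ 3 with hl
  have hl0 : 0 < l := by positivity
  -- The gap between `l` and `l'` absorbs the loss in `1 - q ≥ exp (-q / (1 - q))`, since `q → 0`.
  obtain ⟨l', hl1, hl2⟩ := exists_between hwk
  have hlim : Tendsto (fun N : ℕ => c⁻¹ * a ^ k * (Real.log N ^ ((k : ℝ) / 3) /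
      (N : ℝ) ^ ((k : ℝ) / 3 - l'))) atTop (𝓝 0) := by
    have := ((isLittleO_log_rpow_rpow_atTop (s := (k : ℝ) / 3 - l') ((k : ℝ) / 3)
      (by linarith)).tendsto_div_nhds_zero.comp tendsto_natCast_atTop_atTop).const_mul
      (c⁻¹ * a ^ k)
    rwa [mul_zero] at this
  have hq : Tendsto (fun N : ℕ => l' * (1 - l * (Real.log N / N))) atTop (𝓝 l') := by
    have := ((tendsto_log_div_natCast.const_mul l).const_sub 1).const_mul l'
    simpa using this
  refine tendsto_of_tendsto_of_tendsto_of_le_of_le' tendsto_const_nhds hlim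
    (Eventually.of_forall fun N => by positivity) ?_
  filter_upwards [eventually_ge_atTop 2, eventually_mul_logScale_lt a hr₀,
    hq.eventually (lt_mem_nhds hl1)] with N hN hNr hNq
  have hN0 : (0 : ℝ) < N := by exact_mod_cast (by omega : 0 < N)
  have hL := log_natCast_pos hN
  have hls := logScale_pos hN
  have hl'0 : 0 < l' := hl0.trans hl1
  set q := l * (Real.log N / N) with hqdef
  have hq1 : q < 1 := by
    by_contra! h
    nlinarith
  obtain ⟨t, htc, htP, htd, htw⟩ := hsep (a * logScale N) (by positivity) hNr
  have hwq : w * (a * logScale N) ^ 3 = q := by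
    rw [mul_pow, logScale_pow_three, hqdef, hl]; ring
  rw [hwq] at htw
  have h1 := measureReal_coveringRadius_lt_mul_le hP ν htP htd hq1.le htw (N := N) (by omega)
  have h2 : (N : ℝ) ^ (-l') ≤ (1 - q) ^ N := by
    refine le_trans ?_ (pow_le_pow_left₀ (Real.exp_nonneg _) (exp_neg_div_le hq1) N)
    rw [← Real.exp_nat_mul, Real.rpow_def_of_pos hN0, Real.exp_le_exp, mul_neg, mul_neg,
      neg_le_neg_iff]
    have h3 : q / (1 - q) ≤ l' * (Real.log N / N) := by
      rw [div_le_iff₀ (by linarith), hqdef]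
      have : 0 < Real.log N / N := by positivity
      nlinarith
    calc (N : ℝ) * (q / (1 - q)) ≤ N * (l' * (Real.log N / N)) :=
          mul_le_mul_of_nonneg_left h3 hN0.le
      _ = Real.log N * l' := by field_simp
  have h4 : (1 / (a * logScale N)) ^ k = (a ^ k)⁻¹ * ((N : ℝ) / Real.log N) ^ ((k : ℝ) / 3) := by
    rw [← one_div_logScale_pow hN, ← inv_pow, ← mul_pow]
    congr 1
    field_simp
  rw [h4] at htc
  set D := c * ((a ^ k)⁻¹ * ((N : ℝ) / Real.log N) ^ ((k : ℝ) / 3)) * (N : ℝ) ^ (-l') with hD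
  have hD0 : 0 < D := by positivity
  have h5 : D ≤ t.card * (1 - q) ^ N :=
    mul_le_mul htc h2 (by positivity) (Nat.cast_nonneg _)
  have h6 := (mul_le_mul_of_nonneg_left h5 measureReal_nonneg).trans h1
  rw [← le_div_iff₀ hD0] at h6
  refine h6.trans (le_of_eq ?_)
  rw [hD, Real.div_rpow hN0.le hL.le, Real.rpow_neg hN0.le, Real.rpow_sub hN0]
  have e1 : 0 < (N : ℝ) ^ l' := by positivity
  have e2 : 0 < (N : ℝ) ^ ((k : ℝ) / 3) := by positivity
  have e3 : 0 < Real.log N ^ ((k : ℝ) / 3) := by positivity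
  field_simp

end Tails

/-! ### From tails to moments -/

/-- Convergence of moments from tail estimates. -/
theorem tendsto_integral_rpow_of_tails {Ω : ℕ → Type*} [∀ N, MeasurableSpace (Ω N)]
    (μ : ∀ N, Measure (Ω N)) [∀ N, IsProbabilityMeasure (μ N)] {Y : ∀ N, Ω N → ℝ}
    (hYm : ∀ N, Measurable (Y N)) (hY0 : ∀ N ω, 0 ≤ Y N ω) {D : ℝ} (hD : 0 ≤ D)
    (hYD : ∀ N, ∀ᵐ ω ∂μ N, Y N ω ≤ D) {p A : ℝ} (hp : 0 < p) (hA : 0 < A)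
    (h1 : ∀ a, A < a → Tendsto (fun N => (μ N).real {ω | a * logScale N < Y N ω}) atTop (𝓝 0))
    (h2 : ∃ a, 0 < a ∧ Tendsto (fun N => (μ N).real {ω | a * logScale N < Y N ω} *
      (N : ℝ) ^ (p / 3)) atTop (𝓝 0))
    (h3 : ∀ a, 0 < a → a < A →
      Tendsto (fun N => (μ N).real {ω | Y N ω < a * logScale N}) atTop (𝓝 0)) :
    Tendsto (fun N : ℕ => (∫ ω, Y N ω ^ p ∂μ N) * ((N : ℝ) / Real.log N) ^ (p / 3)) atTop
      (𝓝 (A ^ p)) := by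
  have hint : ∀ N, Integrable (fun ω => Y N ω ^ p) (μ N) := fun N =>
    Integrable.of_bound ((hYm N).pow_const p).aestronglyMeasurable (D ^ p) (by
      filter_upwards [hYD N] with ω hω
      rw [Real.norm_of_nonneg (Real.rpow_nonneg (hY0 N ω) p)]
      exact Real.rpow_le_rpow (hY0 N ω) hω hp.le)
  have hgt : ∀ N c, MeasurableSet {ω | c < Y N ω} := fun N c =>
    measurableSet_lt measurable_const (hYm N)
  have hind : ∀ (N : ℕ) (c d : ℝ), Integrable ({ω | c < Y N ω}.indicator fun _ => d) (μ N) := fun N c d =>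
    (integrable_const d).indicator (hgt N c)
  have hcont : ContinuousAt (fun a : ℝ => a ^ p) A :=
    Real.continuousAt_rpow_const A p (Or.inr hp.le)
  rw [tendsto_order]
  constructor
  · intro B hB
    obtain ⟨a, ⟨ha0, haA⟩, haB⟩ : ∃ a ∈ Ioo 0 A, B < a ^ p := by
      have hev : ∀ᶠ a in 𝓝[<] A, B < a ^ p :=
        (hcont.eventually (lt_mem_nhds hB)).filter_mono nhdsWithin_le_nhds
      obtain ⟨a, ha, ha'⟩ := (hev.and (Ioo_mem_nhdsLT hA)).exists
      exact ⟨a, ha', ha⟩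
    have hlim : Tendsto (fun N : ℕ => a ^ p * (1 - (μ N).real {ω | Y N ω < a * logScale N}))
        atTop (𝓝 (a ^ p)) := by
      have := ((h3 a ha0 haA).const_sub 1).const_mul (a ^ p)
      simpa using this
    filter_upwards [hlim.eventually (lt_mem_nhds haB), eventually_ge_atTop 2] with N hN hN2
    refine hN.trans_le ?_
    have hl := logScale_pos hN2
    set S := {ω | Y N ω < a * logScale N} with hS
    have hSm : MeasurableSet S := measurableSet_lt (hYm N) measurable_const
    have hlow : (a * logScale N) ^ p * (1 - (μ N).real S) ≤ ∫ ω, Y N ω ^ p ∂μ N := by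
      rw [← probReal_compl_eq_one_sub hSm, mul_comm, ← smul_eq_mul,
        ← integral_indicator_const _ hSm.compl]
      refine integral_mono ((integrable_const _).indicator hSm.compl) (hint N) fun ω => ?_
      by_cases hω : ω ∈ S
      · simp only [indicator_of_notMem (notMem_compl_iff.2 hω)]
        exact Real.rpow_nonneg (hY0 N ω) p
      · simp only [indicator_of_mem (mem_compl hω)]
        exact Real.rpow_le_rpow (by positivity) (not_lt.1 hω) hp.le
    have hR : 0 ≤ ((N : ℝ) / Real.log N) ^ (p / 3) := by
      have := log_natCast_pos hN2
      positivity
    refine le_trans (le_of_eq ?_) (mul_le_mul_of_nonneg_right hlow hR)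
    rw [Real.mul_rpow ha0.le hl.le]
    linear_combination (-(a ^ p * (1 - (μ N).real S))) * logScale_rpow_mul hN2 p
  · intro B hB
    obtain ⟨a, haA, haB⟩ : ∃ a, A < a ∧ a ^ p < B := by
      have hev : ∀ᶠ a in 𝓝[>] A, a ^ p < B :=
        (hcont.eventually (gt_mem_nhds hB)).filter_mono nhdsWithin_le_nhds
      obtain ⟨a, ha, ha'⟩ := (hev.and self_mem_nhdsWithin).exists
      exact ⟨a, ha', ha⟩
    obtain ⟨a', ha'0, h2⟩ := h2
    have ha0 : 0 < a := hA.trans haA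
    have hlim : Tendsto (fun N : ℕ => a ^ p + a' ^ p * (μ N).real {ω | a * logScale N < Y N ω} +
        D ^ p * ((μ N).real {ω | a' * logScale N < Y N ω} * (N : ℝ) ^ (p / 3)))
        atTop (𝓝 (a ^ p)) := by
      have := (((h1 a haA).const_mul (a' ^ p)).const_add (a ^ p)).add (h2.const_mul (D ^ p))
      simpa using this
    filter_upwards [hlim.eventually (gt_mem_nhds haB), eventually_ge_atTop 3] with N hN hN3
    refine lt_of_le_of_lt ?_ hN
    have hN2 : 2 ≤ N := by omega
    have hl := logScale_pos hN2
    set S := {ω | a * logScale N < Y N ω} with hS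
    set S' := {ω | a' * logScale N < Y N ω} with hS'
    -- `Y` is bounded by `a l` off `S`, by `a' l` off `S'`, and by `D` almost surely (`l` the
    -- scale). After normalization the middle term vanishes because `S` has small probability, the
    -- last because `S'` has probability `o(N^(-p/3))`.
    have hup : ∫ ω, Y N ω ^ p ∂μ N ≤ (a * logScale N) ^ p +
        (a' * logScale N) ^ p * (μ N).real S + D ^ p * (μ N).real S' := by
      have e : (a * logScale N) ^ p + (a' * logScale N) ^ p * (μ N).real S +
          D ^ p * (μ N).real S' = ∫ ω, ((a * logScale N) ^ p +
            S.indicator (fun _ => (a' * logScale N) ^ p) ω +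
            S'.indicator (fun _ => D ^ p) ω) ∂μ N := by
        have hi : Integrable (fun ω => (a * logScale N) ^ p +
            S.indicator (fun _ => (a' * logScale N) ^ p) ω) (μ N) :=
          (integrable_const _).add (hind N _ _)
        rw [integral_add hi (hind N _ _),
          integral_add (integrable_const _) (hind N _ _), integral_const, probReal_univ, one_smul,
          integral_indicator_const _ (hgt N _), integral_indicator_const _ (hgt N _), smul_eq_mul,
          smul_eq_mul, mul_comm (μ N |>.real S), mul_comm (μ N |>.real S')]
      rw [e]
      refine integral_mono_ae (hint N)
        (((integrable_const _).add (hind N _ _)).add (hind N _ _)) ?_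
      filter_upwards [hYD N] with ω hω
      have hi1 : 0 ≤ S.indicator (fun _ => (a' * logScale N) ^ p) ω :=
        indicator_nonneg (fun _ _ => by positivity) ω
      have hi2 : 0 ≤ S'.indicator (fun _ => D ^ p) ω :=
        indicator_nonneg (fun _ _ => by positivity) ω
      have hi3 : 0 ≤ (a * logScale N) ^ p := by positivity
      by_cases hω1 : ω ∈ S'
      · have := Real.rpow_le_rpow (hY0 N ω) hω hp.le
        rw [indicator_of_mem hω1]
        linarith
      · by_cases hω2 : ω ∈ S
        · have := Real.rpow_le_rpow (hY0 N ω) (not_lt.1 hω1) hp.le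
          rw [indicator_of_mem hω2]
          linarith
        · have := Real.rpow_le_rpow (hY0 N ω) (not_lt.1 hω2) hp.le
          linarith
    have hlog := log_natCast_pos hN2
    have hR : 0 ≤ ((N : ℝ) / Real.log N) ^ (p / 3) := by positivity
    refine (mul_le_mul_of_nonneg_right hup hR).trans ?_
    have hR' := div_log_rpow_le hN3 (by positivity : 0 ≤ p / 3)
    rw [Real.mul_rpow ha0.le hl.le, Real.mul_rpow ha'0.le hl.le]
    have key := logScale_rpow_mul hN2 p
    have h5 : D ^ p * (μ N).real S' * ((N : ℝ) / Real.log N) ^ (p / 3) ≤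
        D ^ p * ((μ N).real S' * (N : ℝ) ^ (p / 3)) := by
      rw [mul_assoc]
      gcongr
    have h6 : (a ^ p * logScale N ^ p + a' ^ p * logScale N ^ p * (μ N).real S) *
        ((N : ℝ) / Real.log N) ^ (p / 3) = a ^ p + a' ^ p * (μ N).real S := by
      linear_combination (a ^ p + a' ^ p * (μ N).real S) * key
    rw [add_mul, h6]
    linarith

/-! ### Uniform samples from a polyhedron -/

section Uniform

variable {P : Set (EuclideanSpace ℝ (Fin 3))}

theorem IsPolyhedron.volume_pos (hP : IsPolyhedron P) : 0 < volume.real P := by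
  have hne : (interior P).Nonempty := by
    rw [← closure_nonempty_iff, hP.solid]
    exact hP.nonempty
  rw [measureReal_def]
  refine ENNReal.toReal_pos ?_ hP.isCompact.measure_lt_top.ne
  exact ((isOpen_interior.measure_pos volume hne).trans_le (measure_mono interior_subset)).ne'

theorem IsPolyhedron.isProbabilityMeasure_cond (hP : IsPolyhedron P) :
    IsProbabilityMeasure (volume[|P]) := by
  refine cond_isProbabilityMeasure_of_finite ?_ hP.isCompact.measure_lt_top.ne
  intro h
  have := hP.volume_pos
  rw [measureReal_def, h] at this
  simp at this

theorem IsPolyhedron.cond_real_apply (hP : IsPolyhedron P)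
    (B : Set (EuclideanSpace ℝ (Fin 3))) :
    (volume[|P]).real B = volume.real (P ∩ B) / volume.real P := by
  rw [measureReal_def, cond_apply hP.isCompact.measurableSet, ENNReal.toReal_mul,
    ENNReal.toReal_inv, div_eq_inv_mul]
  rfl

theorem IsPolyhedron.ae_forall_mem (hP : IsPolyhedron P) (N : ℕ) :
    ∀ᵐ x ∂(Measure.pi fun _ : Fin N => volume[|P]), ∀ j, x j ∈ P := by
  have := hP.isProbabilityMeasure_cond
  rw [ae_all_iff]
  intro j
  exact (Measure.quasiMeasurePreserving_eval (fun _ : Fin N => volume[|P]) j).ae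
    (ae_cond_mem hP.isCompact.measurableSet)

theorem IsPolyhedron.integrable_coveringRadius_rpow (hP : IsPolyhedron P) (N : ℕ) {p : ℝ}
    (hp : 0 < p) : Integrable (fun x => coveringRadius P x ^ p)
      (Measure.pi fun _ : Fin N => volume[|P]) := by
  have := hP.isProbabilityMeasure_cond
  refine Integrable.of_bound ((continuous_coveringRadius hP.isCompact.isBounded).measurable.pow_const
    p).aestronglyMeasurable (Metric.diam P ^ p) ?_
  filter_upwards [hP.ae_forall_mem N] with x hx
  rw [Real.norm_of_nonneg (Real.rpow_nonneg (coveringRadius_nonneg x) p)]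
  exact Real.rpow_le_rpow (coveringRadius_nonneg x)
    (coveringRadius_le hP.isCompact.isBounded hx) hp.le

/-- The limit for the moments of the covering radius, in terms of the volume bounds at the points
that determine it. -/
theorem IsPolyhedron.tendsto_integral_coveringRadius (hP : IsPolyhedron P) {p κ A w : ℝ}
    (hp : 0 < p) (hκ0 : 0 < κ) (hκ : κ ≤ Real.pi) (hκα : ∀ α, IsDihedralAngle P α → κ ≤ α)
    (hA : 0 < A) (hA1 : volume.real P ≤ 2 * κ * A ^ 3) (hA2 : volume.real P ≤ Real.pi * A ^ 3)
    {k : ℕ} (hw : 0 < w) (hA3 : w * A ^ 3 = k / 3 * volume.real P)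
    (hsep : ∃ c : ℝ, 0 < c ∧ ∃ r₀ : ℝ, 0 < r₀ ∧ ∀ r : ℝ, 0 < r → r < r₀ →
      ∃ t : Finset (EuclideanSpace ℝ (Fin 3)), c * (1 / r) ^ k ≤ t.card ∧ (∀ q ∈ t, q ∈ P) ∧
        (∀ q ∈ t, ∀ q' ∈ t, q ≠ q' → Disjoint (Metric.ball q r) (Metric.ball q' r)) ∧
        ∀ q ∈ t, volume.real (P ∩ Metric.ball q r) ≤ w * r ^ 3) :
    Tendsto (fun N : ℕ => (∫ x, coveringRadius P x ^ p ∂(Measure.pi fun _ : Fin N => volume[|P])) *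
      ((N : ℝ) / Real.log N) ^ (p / 3)) atTop (𝓝 (A ^ p)) := by
  have hprob := hP.isProbabilityMeasure_cond
  have hbdd := hP.isCompact.isBounded
  have hV := hP.volume_pos
  set V := volume.real P with hVdef
  have hπ := Real.pi_pos
  obtain ⟨c, hc, hnets⟩ := hP.exists_nets hκ hκα
  let v : Fin 4 → ℝ := ![c, 2 * κ / 3, 2 * Real.pi / 3, 4 * Real.pi / 3]
  have hv0 : ∀ i, 0 < v i := by
    intro i
    fin_cases i <;> simp only [v] <;> simp <;> positivity
  have hnets' : ∀ ε : ℝ, 0 < ε → ∃ C : ℝ, 0 < C ∧ ∃ r₀ : ℝ, 0 < r₀ ∧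
      ∀ r : ℝ, 0 < r → r < r₀ → ∃ t : Fin 4 → Finset (EuclideanSpace ℝ (Fin 3)),
        (∀ k, ((t k).card : ℝ) ≤ C * (1 / r) ^ (k : ℕ)) ∧
        (∀ y ∈ P, ∃ k, ∃ q ∈ t k, dist y q ≤ ε * r) ∧
        ∀ k, ∀ q ∈ t k, v k / V * r ^ 3 ≤ (volume[|P]).real (Metric.ball q r) := by
    intro ε hε
    obtain ⟨C, hC, r₀, hr₀, h⟩ := hnets ε hε
    refine ⟨C, hC, r₀, hr₀, fun r hr hrr => ?_⟩
    obtain ⟨t, h1, h2, h3⟩ := h r hr hrr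
    refine ⟨t, h1, h2, fun k q hq => ?_⟩
    rw [hP.cond_real_apply, div_mul_eq_mul_div]
    exact div_le_div_of_nonneg_right (h3 k q hq) hV.le
  refine tendsto_integral_rpow_of_tails (fun N => Measure.pi fun _ : Fin N => volume[|P])
    (Y := fun N x => coveringRadius P x) (fun N => (continuous_coveringRadius hbdd).measurable)
    (fun N x => coveringRadius_nonneg x) (D := Metric.diam P) Metric.diam_nonneg (fun N => ?_) hp hA
    (fun a ha => ?_) ?_ (fun a ha haA => ?_)
  · filter_upwards [hP.ae_forall_mem N] with x hx
    exact coveringRadius_le hbdd hx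
  · obtain ⟨b, hAb, hba⟩ := exists_between ha
    have hb : 0 < b := hA.trans hAb
    have hε : 0 < a / b - 1 := by rw [sub_pos, lt_div_iff₀ hb]; linarith
    have hAb3 : A ^ 3 < b ^ 3 := pow_lt_pow_left₀ hAb hA.le (by norm_num)
    -- For `A < b < a` the four exponent conditions hold: vertices trivially, edges by `hA1`, faces
    -- by `hA2`, and the interior by `hA2` with room to spare. Taking `ε = a / b - 1` turns the
    -- radius `b` into `a`.
    have h := tendsto_measureReal_coveringRadius_gt (m := 0) hε hb (hnets' _ hε) (by
      intro i
      rw [add_zero, div_mul_eq_mul_div, lt_div_iff₀ hV]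
      have h1 := mul_lt_mul_of_pos_left hAb3 (by positivity : 0 < 2 * κ)
      have h2 := mul_lt_mul_of_pos_left hAb3 hπ
      fin_cases i <;> simp [v]
      · positivity
      · linarith
      · linarith
      · nlinarith)
    simp only [Real.rpow_zero, mul_one] at h
    have e : ∀ N, (1 + (a / b - 1)) * (b * logScale N) = a * logScale N := fun N => by
      field_simp; ring
    simpa only [e] using h
  · obtain ⟨b, hb, hb0⟩ : ∃ b : ℝ, (∀ i : Fin 4, (i : ℝ) / 3 + p / 3 < v i / V * b ^ 3) ∧ 0 < b := by
      have hev : ∀ᶠ b : ℝ in atTop, ∀ i : Fin 4, (i : ℝ) / 3 + p / 3 < v i / V * b ^ 3 := by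
        rw [eventually_all]
        intro i
        exact ((tendsto_pow_atTop (by norm_num)).const_mul_atTop
          (div_pos (hv0 i) hV)).eventually_gt_atTop _
      exact (hev.and (eventually_gt_atTop 0)).exists
    refine ⟨2 * b, by positivity, ?_⟩
    have h := tendsto_measureReal_coveringRadius_gt (m := p / 3) one_pos hb0 (hnets' 1 one_pos) hb
    have e : ∀ N, (1 + 1) * (b * logScale N) = 2 * b * logScale N := fun N => by ring
    simpa only [e] using h
  · refine tendsto_measureReal_coveringRadius_lt hbdd (k := k) (w := w / V) (by positivity) ha ?_ ?_
    · obtain ⟨c', hc', r₀, hr₀, h⟩ := hsep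
      refine ⟨c', hc', r₀, hr₀, fun r hr hrr => ?_⟩
      obtain ⟨t, h1, h2, h3, h4⟩ := h r hr hrr
      refine ⟨t, h1, h2, h3, fun q hq => ?_⟩
      rw [hP.cond_real_apply, div_mul_eq_mul_div]
      exact div_le_div_of_nonneg_right (h4 q hq) hV.le
    · rw [div_mul_eq_mul_div, div_lt_iff₀ hV, ← hA3]
      exact mul_lt_mul_of_pos_left (pow_lt_pow_left₀ haA ha.le (by norm_num)) hw

theorem map_eq_pi_of_isUniform {Ω : Type*} [MeasurableSpace Ω] {μ : Measure Ω}
    [IsProbabilityMeasure μ] (hP : IsPolyhedron P) {N : ℕ}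
    {X : Fin N → Ω → EuclideanSpace ℝ (Fin 3)} (hindep : iIndepFun X μ)
    (hunif : ∀ i, pdf.IsUniform (X i) P μ volume) :
    AEMeasurable (fun ω i => X i ω) μ ∧
      μ.map (fun ω i => X i ω) = Measure.pi fun _ => volume[|P] := by
  have h0 : volume P ≠ 0 := by
    intro h
    have := hP.volume_pos
    rw [measureReal_def, h] at this
    simp at this
  have hm : ∀ i, AEMeasurable (X i) μ := fun i =>
    -- The law is nonzero because `P` has positive finite volume, whereas a map that is not almost
    -- everywhere measurable would push `μ` forward to zero.
    (hunif i).aemeasurable h0 hP.isCompact.measure_lt_top.ne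
  refine ⟨aemeasurable_pi_lambda _ hm, ?_⟩
  rw [(iIndepFun_iff_map_fun_eq_pi_map hm).1 hindep]
  congr 1
  funext i
  exact hunif i

end Uniform

/-! ### The two regimes of the smallest dihedral angle -/

theorem rpow_one_third_rpow {x : ℝ} (hx : 0 ≤ x) (p : ℝ) : (x ^ (1 / 3 : ℝ)) ^ p = x ^ (p / 3) := by
  rw [← Real.rpow_mul hx]
  congr 1
  ring

theorem rpow_one_third_pow {x : ℝ} (hx : 0 ≤ x) : (x ^ (1 / 3 : ℝ)) ^ 3 = x := by
  rw [← Real.rpow_natCast, rpow_one_third_rpow hx]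
  norm_num

theorem mainTheorem8
    (P : Set (EuclideanSpace ℝ (Fin 3))) (hP : IsPolyhedron P)
    (θ : ℝ) (hθ : IsLeast {α : ℝ | IsDihedralAngle P α} θ)
    (p : ℝ) (hp : 1 ≤ p)
    {Ω : ℕ → Type*} [∀ N, MeasurableSpace (Ω N)]
    (μ : ∀ N, Measure (Ω N)) [∀ N, IsProbabilityMeasure (μ N)]
    (X : ∀ N, Fin N → Ω N → EuclideanSpace ℝ (Fin 3))
    (hindep : ∀ N, iIndepFun (X N) (μ N))
    (hunif : ∀ N i, pdf.IsUniform (X N i) P (μ N) volume) :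
    (∀ N, Integrable (fun ω => coveringRadius P (fun i => X N i ω) ^ p) (μ N)) ∧
    (θ ≤ Real.pi / 2 →
      Tendsto
        (fun N : ℕ => (∫ ω, coveringRadius P (fun i => X N i ω) ^ p ∂(μ N)) *
          ((N : ℝ) / Real.log N) ^ (p / 3))
        atTop
        (𝓝 ((2 * Real.pi * volume.real P /
          (3 * θ * volume.real (Metric.ball (0 : EuclideanSpace ℝ (Fin 3)) 1))) ^ (p / 3))) ∧
      (2 * Real.pi * volume.real P /
          (3 * θ * volume.real (Metric.ball (0 : EuclideanSpace ℝ (Fin 3)) 1))) ^ (p / 3) =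
        (volume.real P / (2 * θ)) ^ (p / 3)) ∧
    (Real.pi / 2 ≤ θ →
      Tendsto
        (fun N : ℕ => (∫ ω, coveringRadius P (fun i => X N i ω) ^ p ∂(μ N)) *
          ((N : ℝ) / Real.log N) ^ (p / 3))
        atTop (𝓝 ((volume.real P / Real.pi) ^ (p / 3)))) := by
  have hp0 : 0 < p := by linarith
  have hV := hP.volume_pos
  have hπ := Real.pi_pos
  have hmap := fun N => map_eq_pi_of_isUniform hP (hindep N) (hunif N)
  have hprob := hP.isProbabilityMeasure_cond
  have hint : ∀ N, ∫ ω, coveringRadius P (fun i => X N i ω) ^ p ∂(μ N) =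
      ∫ x, coveringRadius P x ^ p ∂(Measure.pi fun _ : Fin N => volume[|P]) := by
    intro N
    rw [← (hmap N).2, integral_map (hmap N).1]
    rw [(hmap N).2]
    exact (hP.integrable_coveringRadius_rpow N hp0).aestronglyMeasurable
  obtain ⟨⟨⟨hθ0, hθ2⟩, hθπ, x, hx⟩, hmin⟩ := hθ
  have hpos : 0 < volume.real P / (2 * θ) := by positivity
  refine ⟨fun N => ?_, fun hle => ?_, fun hge => ?_⟩
  · have h := hP.integrable_coveringRadius_rpow N hp0
    rw [← (hmap N).2] at h
    exact h.comp_aemeasurable (hmap N).1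
  · have hconst : 2 * Real.pi * volume.real P /
        (3 * θ * volume.real (Metric.ball (0 : EuclideanSpace ℝ (Fin 3)) 1)) =
        volume.real P / (2 * θ) := by
      rw [volume_real_ball_fin_three 0 zero_le_one]
      field_simp
      norm_num
    rw [hconst]
    refine ⟨?_, rfl⟩
    simp_rw [hint]
    rw [← rpow_one_third_rpow hpos.le]
    have hA3 := rpow_one_third_pow hpos.le
    -- Edges decide: `k = 1` and `w = 2θ/3`. The face condition `V ≤ π A³` is exactly where `θ ≤
    -- π/2` enters.
    refine hP.tendsto_integral_coveringRadius (κ := θ) (w := 2 * θ / 3) (k := 1) hp0 hθ0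
      (by linarith) (fun α hα => hmin hα) (by positivity) ?_ ?_ (by positivity) ?_
      (hx.exists_separated_edge hθ0 (by linarith))
    · rw [hA3]
      exact le_of_eq (by field_simp)
    · rw [hA3, mul_div_assoc', le_div_iff₀ (by positivity)]
      nlinarith
    · rw [hA3]
      field_simp
      norm_num
  · have hpos' : 0 < volume.real P / Real.pi := by positivity
    simp_rw [hint]
    rw [← rpow_one_third_rpow hpos'.le]
    have hA3 := rpow_one_third_pow hpos'.le
    -- Faces decide: `k = 2` and `w = 2π/3`. The minimum is needed because all edges may be reflex,
    -- and a reflex wedge guarantees only a half-ball. The required face is one adjacent to the edge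
    -- of angle `θ`.
    refine hP.tendsto_integral_coveringRadius (κ := min θ Real.pi) (w := 2 * Real.pi / 3) (k := 2)
      hp0 (lt_min hθ0 hπ) (min_le_right _ _) (fun α hα => (min_le_left _ _).trans (hmin hα))
      (by positivity) ?_ ?_ (by positivity) ?_ (hx.exists_separated_face hθ0 hθ2)
    · rw [hA3, mul_div_assoc', le_div_iff₀ hπ]
      have : Real.pi / 2 ≤ min θ Real.pi := le_min hge (by linarith)
      nlinarith
    · rw [hA3]
      exact le_of_eq (by field_simp)
    · rw [hA3]
      push_cast
      field_simp
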